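/- Setting. Each of $N$ servers stores the same $M$ records $W_1,\dots,W_M$, which are independent and uniformly distributed in $\mathbb F_q^L$; $L$ is called the sub-packetization. A (PIR) scheme consists of private randomness $S$ of the user (finitely valued, independent of the records), queries $(Q_\theta^{(1)},\dots,Q_\theta^{(N)})=\mathrm{Que}(\theta,S)$ and answers $A_\theta^{(i)}=\mathrm{Ans}^{(i)}(Q_\theta^{(i)},W_{[M]})$. It is a $T$-PIR scheme if it is correct, $H(W_\theta\mid A_\theta^{[N]},Q_\theta^{[N]},S,\theta)=0$ for every $\theta\in[M]$, and $T$-private, $I(\theta;Q_\theta^{\Gamma},A_\theta^{\Gamma},W_{[M]})=0$ for all $\Gamma\subseteq[N]$ with $|\Gamma|=T$ and every prior distribution of $\theta$. Its rate is $H(W_\theta)/\sum_{i=1}^N H(A_\theta^{(i)})$, and the capacity $C(N,T,M)$ is the largest rate of a $T$-PIR scheme (over all finite fields and all $L$). A scheme is linear if, for every query, its answers are vectors over $\mathbb F_q$ that depend linearly on the records; it is capacity-achieving if its rate (for every $\theta$) equals the capacity. A matrix $G=(G^{(1)},\dots,G^{(N)})\in\mathbb F_q^{T\ell\times N\ell}$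 with thick columns $G^{(i)}\in\mathbb F_q^{T\ell\times\ell}$ generates an $(N,T;\ell)$ MDS array code if any $T$ thick columns together have rank $T\ell$. It has the recovery property for $(m_1,\dots,m_N)$, where $0\le m_i\le\ell$ and $\sum_i m_i=T\ell$, if the first $m_i$ columns of the $G^{(i)}$, $i\in[N]$, together have rank $T\ell$. Construction. Let $1\le T<N$, $M\ge2$, $d=\gcd(N,T)$, $n=N/d$, $t=T/d$, $L=Nn^{M-2}$ and $\ell_k=(n-t)^{k-1}t^{M-1-k}$ for $1\le k\le M-1$. A design over $\mathbb F_q$ consists of the following. - Non-negative integers $\alpha_k,\beta_k$ $(1\le k\le M)$ such that, with $\gamma_k^{(i)}=\alpha_k$ for $i\le T$ and $\gamma_k^{(i)}=\beta_k$ for $i>T$, we have $\gamma_k^{(i)}+\gamma_{k+1}^{(i)}=\ell_k$ and $\sum_i\gamma_k^{(i)}=T\ell_k$ for $1\le k\le M-1$. - For $1\le k\le M-1$, a generator matrix $G_k$ of an $(N,T;\ell_k)$ MDS array code over $\mathbb F_q$ with the recovery property for $(\gamma_k^{(1)},\dots,\gamma_k^{(N)})$. - For each $\theta\in[M]$, an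 assignment of columns of $L\times L$ matrices $S_1,\dots,S_M$ as follows. Server $i$ is to return, for each non-empty $\Lambda\subseteq[M]$, $\gamma_{|\Lambda|}^{(i)}$ sums of type $\Lambda$. The sums (over all servers) whose type contains $\theta$ are matched bijectively with the columns of $S_\theta$. For $j\ne\theta$, each set $\Lambda\ni j$ with $\theta\notin\Lambda$ is given a list of $T\ell_{|\Lambda|}$ distinct columns of $S_j$, the lists of different $\Lambda$ being disjoint. The scheme of a design: the user draws $S_1,\dots,S_M$ independently and uniformly from the invertible $L\times L$ matrices over $\mathbb F_q$. For $j\neq\theta$ and $\Lambda\ni j$ with $\theta\notin\Lambda$, the subvector of $W_jS_j$ on the columns assigned to $\Lambda$ is encoded by $G_{|\Lambda|}$; call the result the codeword of $(j,\Lambda)$. A sum of type $\Lambda\not\ni\theta$ at server $i$ adds up, over $j\in\Lambda$, one of the first $\gamma_{|\Lambda|}^{(i)}$ symbols of the $i$-th block of the codeword of $(j,\Lambda)$ (the $r$-th one in the $r$-th sum). A sum of type $\Lambda\ni\theta$ at server $i$ is its own entry of $W_\theta S_\theta$ plus the sum, over $j\in\Lambda\setminus\{\theta\}$, of one of the remaining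 $\gamma_{|\Lambda|}^{(i)}$ symbols of the $i$-th block of the codeword of $(j,\Lambda\setminus\{\theta\})$ (the $r$-th remaining one in the $r$-th sum). The query to a server is the list of the coefficients of its sums as linear forms in the entries of the records, and its answer is the list of the values of its sums. Theorem. Let $1\le T<N$ and $M\ge2$, put $\ell=\min\{t^{M-2},(n-t)^{M-2}\}$, and let $\mathbb F_q$ be a finite field with $q\ge N^{1/\ell}$. Then: 1. the capacity is $C(N,T,M)=\dfrac{1-T/N}{1-(T/N)^M}$; 2. a design over $\mathbb F_q$ exists; 3. the scheme of every design over $\mathbb F_q$ is a linear $T$-PIR scheme over $\mathbb F_q$ with sub-packetization $Nn^{M-2}$ whose rate equals the capacity; 4. this sub-packetization is optimal: every linear capacity-achieving $T$-PIR scheme for $N$ servers and $M$ records, over any finite field, has sub-packetization at least $Nn^{M-2}$. -/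

import Mathlib

namespace TPIR

/-! ### Shannon entropy of discrete random variables (in nats) -/

/-- Shannon entropy `H(X)` of a random variable `X` on a discrete probability space `(Ω, P)`.
It is only used for variables with finitely many values. -/
noncomputable def entropy {Ω A : Type} (P : PMF Ω) (X : Ω → A) : ℝ :=
  ∑' a, Real.negMulLog ((P.map X a).toReal)

/-- Conditional entropy `H(X | Y) = H(X, Y) - H(Y)`. -/
noncomputable def condEntropy {Ω A B : Type} (P : PMF Ω) (X : Ω → A) (Y : Ω → B) : ℝ :=
  entropy P (fun ω => (X ω, Y ω)) - entropy P Y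

/-- Mutual information `I(X ; Y) = H(X) + H(Y) - H(X, Y)`. -/
noncomputable def mutualInfo {Ω A B : Type} (P : PMF Ω) (X : Ω → A) (Y : Ω → B) : ℝ :=
  entropy P X + entropy P Y - entropy P (fun ω => (X ω, Y ω))

/-! ### The `T`-PIR model -/

/-- The contents of the database: `M` records, each a vector of length `L` over `F`. -/
abbrev Records (F : Type) (M L : ℕ) : Type := Fin M → Fin L → F

/-- The data of a retrieval scheme with `N` servers, each of which stores all `M` records:
the private randomness of the user, a query function and the answer functions. -/
structure Scheme (F : Type) (N M L : ℕ) where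
  /-- values of the user's random resources -/
  Seed : Type
  /-- alphabet of the queries to server `i` -/
  Query : Fin N → Type
  /-- alphabet of the answers of server `i` -/
  Ans : Fin N → Type
  finiteSeed : Finite Seed
  finiteQuery : ∀ i, Finite (Query i)
  finiteAns : ∀ i, Finite (Ans i)
  /-- law of the user's random resources -/
  seedLaw : PMF Seed
  /-- the query sent to server `i` for retrieving record `θ` -/
  que : Fin M → Seed → (i : Fin N) → Query i
  /-- the answer of server `i` to a query -/
  ans : (i : Fin N) → Query i → Records F M L → Ans i

namespace Scheme

variable {F : Type} {N M L : ℕ}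

/-- The answer of server `i` when record `θ` is retrieved. -/
def answer (S : Scheme F N M L) (θ : Fin M) (s : S.Seed) (W : Records F M L) (i : Fin N) :
    S.Ans i :=
  S.ans i (S.que θ s i) W

variable [Field F] [Fintype F]

/-- Joint law of the user's random resources and the records: they are independent, and the
records are independent and uniformly distributed. -/
noncomputable def law (S : Scheme F N M L) : PMF (S.Seed × Records F M L) :=
  S.seedLaw.bind fun s => (PMF.uniformOfFintype (Records F M L)).map fun W => (s, W)

/-- Joint law of the index `θ` with prior `π`, the random resources and the records; `θ` is
independent of the rest. -/
noncomputable def lawWithIndex (S : Scheme F N M L) (π : PMF (Fin M)) :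
    PMF (Fin M × S.Seed × Records F M L) :=
  π.bind fun θ => S.law.map fun ω => (θ, ω)

/-- Correctness: `H(W_θ | A_θ, Q_θ, S, θ) = 0`, for each value of `θ`. -/
def IsCorrect (S : Scheme F N M L) : Prop :=
  ∀ θ : Fin M,
    condEntropy S.law (fun ω => ω.2 θ)
      (fun ω => ((fun i : Fin N => S.answer θ ω.1 ω.2 i), S.que θ ω.1, ω.1)) = 0

/-- `T`-privacy: `I(θ ; Q_θ^Γ, A_θ^Γ, W) = 0` for every set `Γ` of `T` servers, whatever the
prior distribution of `θ`. -/
def IsPrivate (S : Scheme F N M L) (T : ℕ) : Prop :=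
  ∀ Γ : Finset (Fin N), Γ.card = T → ∀ π : PMF (Fin M),
    mutualInfo (S.lawWithIndex π) (fun ω => ω.1)
      (fun ω => ((fun i : Γ => S.que ω.1 ω.2.1 i.1),
        (fun i : Γ => S.answer ω.1 ω.2.1 ω.2.2 i.1), ω.2.2)) = 0

/-- A `T`-PIR scheme. -/
def IsTPIR (S : Scheme F N M L) (T : ℕ) : Prop :=
  S.IsCorrect ∧ S.IsPrivate T

/-- The rate `H(W_θ) / ∑ i, H(A_θ^(i))`. -/
noncomputable def rate (S : Scheme F N M L) (θ : Fin M) : ℝ :=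
  entropy S.law (fun ω => ω.2 θ) / ∑ i, entropy S.law (fun ω => S.answer θ ω.1 ω.2 i)

/-- A scheme is linear if the answers are vectors over `F` that depend linearly on the records,
for every query. -/
def IsLinear (S : Scheme F N M L) : Prop :=
  ∃ (len : Fin N → ℕ) (e : ∀ i, S.Ans i ≃ (Fin (len i) → F)),
    ∀ (i : Fin N) (x : S.Query i), ∃ φ : Records F M L →ₗ[F] (Fin (len i) → F),
      ∀ W, e i (S.ans i x W) = φ W

end Scheme

/-- The rates of all `T`-PIR schemes with `N` servers and `M` records, of any length over any
finite field. -/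
def achievableRates (N T M : ℕ) : Set ℝ :=
  {R | ∃ (K : Type) (_ : Field K) (_ : Fintype K) (L : ℕ) (S : Scheme K N M L),
    S.IsTPIR T ∧ ∃ θ, R = S.rate θ}

/-- `C` is the capacity: the largest rate of a `T`-PIR scheme. -/
def IsCapacity (N T M : ℕ) (C : ℝ) : Prop := IsGreatest (achievableRates N T M) C

/-- `S` is a linear `T`-PIR scheme whose rate is the capacity. -/
def IsLinearCapacityAchieving {K : Type} [Field K] [Fintype K] {N M L : ℕ}
    (S : Scheme K N M L) (T : ℕ) : Prop :=
  S.IsLinear ∧ S.IsTPIR T ∧ ∀ θ, IsCapacity N T M (S.rate θ)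

/-! ### MDS array codes -/

/-- `G = (G^(1), …, G^(N))`, with thick columns `G^(i)` of size `Tℓ × ℓ`, generates an
`(N, T; ℓ)` MDS array code: any `T` thick columns form a matrix of rank `Tℓ`. -/
def IsMDSArrayGenerator {F : Type} [Field F] {N T ℓ : ℕ}
    (G : Matrix (Fin (T * ℓ)) (Fin N × Fin ℓ) F) : Prop :=
  T < N ∧ ∀ Γ : Finset (Fin N), Γ.card = T →
    (G.submatrix id (fun c : Γ × Fin ℓ => ((c.1 : Fin N), c.2))).rank = T * ℓ

/-- Recovery property for `(m_1, …, m_N)`: each `m_i` is at most `ℓ`, `∑ i, m_i = Tℓ`, and the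
first `m_i` columns of the thick columns `G^(i)` together form a matrix of rank `Tℓ`. -/
def HasRecovery {F : Type} [Field F] {N T ℓ : ℕ}
    (G : Matrix (Fin (T * ℓ)) (Fin N × Fin ℓ) F) (m : Fin N → ℕ) : Prop :=
  (∀ i, m i ≤ ℓ) ∧ ∑ i, m i = T * ℓ ∧
    (G.submatrix id
      (Subtype.val : {c : Fin N × Fin ℓ // (c.2 : ℕ) < m c.1} → Fin N × Fin ℓ)).rank = T * ℓ

/-! ### The scheme built from MDS array codes -/

/-- `n = N / gcd(N, T)`. -/
def redN (N T : ℕ) : ℕ := N / Nat.gcd N T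

/-- `t = T / gcd(N, T)`. -/
def redT (N T : ℕ) : ℕ := T / Nat.gcd N T

/-- `ℓ_k = (n - t)^(k-1) t^(M-1-k)`, for `1 ≤ k ≤ M - 1`. -/
def blockLen (N T M k : ℕ) : ℕ := (redN N T - redT N T) ^ (k - 1) * redT N T ^ (M - 1 - k)

/-- The sub-packetization `N n^(M-2)`. -/
def subpack (N T M : ℕ) : ℕ := N * redN N T ^ (M - 2)

/-- `γ_k^(i)`, which is `α_k` for the first `T` servers and `β_k` for the others. -/
def sumCount (T : ℕ) {N : ℕ} (α β : ℕ → ℕ) (k : ℕ) (i : Fin N) : ℕ :=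
  if (i : ℕ) < T then α k else β k

/-- The sums that server `i` returns: for every nonempty set `Λ` of records there are
`γ_|Λ|^(i)` sums of type `Λ`. -/
abbrev Sums (T M : ℕ) {N : ℕ} (α β : ℕ → ℕ) (i : Fin N) : Type :=
  (Λ : {Λ : Finset (Fin M) // Λ.Nonempty}) × Fin (sumCount T α β Λ.1.card i)

/-- The parameters of the scheme: the numbers `α_k`, `β_k` of sums, the `M - 1` MDS array codes
with the recovery property, and the assignment of the columns of the random matrices to the
symbols. Values of `α`, `β` for indices outside `1, …, M` and of `G` outside `1, …, M - 1` are
irrelevant. -/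
structure Design (F : Type) [Field F] (N T M : ℕ) where
  α : ℕ → ℕ
  β : ℕ → ℕ
  /-- the thick columns of the `k`-th code split into `γ_k^(i)` and `γ_(k+1)^(i)` columns -/
  split : ∀ k, 1 ≤ k → k < M → ∀ i : Fin N,
    sumCount T α β k i + sumCount T α β (k + 1) i = blockLen N T M k
  /-- generator matrix of the `k`-th code -/
  G : (k : ℕ) → Matrix (Fin (T * blockLen N T M k)) (Fin N × Fin (blockLen N T M k)) F
  mds : ∀ k, 1 ≤ k → k < M → IsMDSArrayGenerator (G k)
  recovery : ∀ k, 1 ≤ k → k < M → HasRecovery (G k) (sumCount T α β k)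
  /-- the column of `S_θ` for the symbol of the desired record `θ` in a given sum -/
  desiredCol : Fin M → ((i : Fin N) × Sums T M α β i) → Fin (subpack N T M)
  /-- every column of `S_θ` is used exactly once, in the sums that involve record `θ` -/
  desiredCol_bij : ∀ θ, Set.BijOn (desiredCol θ) {x | θ ∈ x.2.1.1} Set.univ
  /-- the columns of `S_j` that are encoded, for each set `Λ` of undesired records, by the code
  with index `|Λ|`, when record `θ` is retrieved -/
  sideCol : Fin M → Fin M → ((Λ : Finset (Fin M)) × Fin (T * blockLen N T M Λ.card)) →
    Fin (subpack N T M)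
  /-- disjoint sets of columns of `S_j` are used for different sets `Λ` that contain `j` -/
  sideCol_inj : ∀ θ j, j ≠ θ → Set.InjOn (sideCol θ j) {x | j ∈ x.1 ∧ θ ∉ x.1}

namespace Design

variable {F : Type} [Field F] {N T M : ℕ}

/-- The coefficient vector of the `(i, c)`-th symbol (`i` the thick column, `c` the position in
it, counted from `0`) of the codeword
`W_j S_j[:, columns assigned to Λ] G_|Λ|`. -/
def codeSymbol (D : Design F N T M) (θ j : Fin M) (Λ : Finset (Fin M))
    (A : Matrix (Fin (subpack N T M)) (Fin (subpack N T M)) F) (i : Fin N) (c : ℕ) :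
    Fin (subpack N T M) → F :=
  if h : c < blockLen N T M Λ.card then
    fun a => ∑ m, A a (D.sideCol θ j ⟨Λ, m⟩) * D.G Λ.card m (i, ⟨c, h⟩)
  else 0

/-- The coefficient vector of record `j` in the sum `x` of server `i`, when record `θ` is
retrieved with the random matrices `S`. A sum of type `Λ` has no contribution of `j ∉ Λ`. The
desired record contributes a fresh symbol of `W_θ S_θ`. An undesired record `j ∈ Λ` contributes
one of the first `γ_k^(i)` symbols in the `i`-th block of its codeword for `Λ` if `θ ∉ Λ`, where
`k = |Λ|`, and one of the remaining `γ_(k+1)^(i)` symbols in the `i`-th block of its codeword for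
`Λ \ {θ}` if `θ ∈ Λ`, where `k = |Λ \ {θ}|`. -/
def coeff (D : Design F N T M) (θ : Fin M)
    (S : Fin M → GL (Fin (subpack N T M)) F) (i : Fin N) (x : Sums T M D.α D.β i)
    (j : Fin M) : Fin (subpack N T M) → F :=
  if j ∉ x.1.1 then 0
  else if j = θ then fun a => (S θ).1 a (D.desiredCol θ ⟨i, x⟩)
  else if θ ∉ x.1.1 then D.codeSymbol θ j x.1.1 (S j).1 i x.2
  else D.codeSymbol θ j (x.1.1.erase θ) (S j).1 i
    (sumCount T D.α D.β (x.1.1.erase θ).card i + x.2)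

variable [Fintype F]

/-- The scheme: the user draws `M` independent uniformly random invertible matrices
`S_1, …, S_M`, sends to each server the coefficients of its sums, and the server returns
these linear combinations of the symbols of the records. -/
noncomputable def scheme (D : Design F N T M) : Scheme F N M (subpack N T M) :=
  letI : Fintype (Fin M → GL (Fin (subpack N T M)) F) := Fintype.ofFinite _
  { Seed := Fin M → GL (Fin (subpack N T M)) F
    Query := fun i => Sums T M D.α D.β i → Fin M → Fin (subpack N T M) → F
    Ans := fun i => Sums T M D.α D.β i → F
    finiteSeed := inferInstance
    finiteQuery := fun _ => inferInstance
    finiteAns := fun _ => inferInstance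
    seedLaw := PMF.uniformOfFintype _
    que := fun θ S i => D.coeff θ S i
    ans := fun _ Q W x => ∑ j, ∑ a, Q x j a * W j a }

end Design

end TPIR

/-! Converse. Fix the user's randomness. For a set Λ of known records, H(A_θ^Γ | W_Λ) is a monotone
submodular function of the set Γ of servers. Correctness gives H(A_θ^[N] | W_Λ) = L log q +
H(A_θ^[N] | W_Λ, W_θ) for θ ∉ Λ. Privacy amounts to this: the joint law of the queries to any T
servers does not depend on θ (`Scheme.isPrivate_iff`). So the mean of H(A_θ^Γ | W_Λ) over the
randomness, for |Γ| = T, may be computed with another record θ'. Monotonicity for θ and Han's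
inequality for θ' then bound the mean of H(A_θ^[N] | W_Λ) below by T/N times that of H(A_θ'^[N] |
W_Λ) (`Scheme.mean_cond_step`). Iterating over the records, the download is at least L log q (1 +
T/N + … + (T/N)^(M-1)).

Optimal sub-packetization. If the rate meets this bound, all these inequalities are equalities.
Equality in Han's inequality makes the conditional entropy additive over servers, and equality in
monotonicity makes it equal on all T-sets; together every server contributes the same amount
(`Scheme.cond_of_tight`). For a linear scheme that amount is an integer multiple of log q, so L (1 +
… + (T/N)^(m-1)) ∈ N ℤ for 1 ≤ m < M. As n and t are coprime, this forces N n^(M-2) to divide L.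

The scheme. T servers see linearly independent coefficient vectors for each record (disjoint
columns, MDS property), and a uniform invertible matrix hides which independent family was used. The
sums of type Λ ∌ θ determine the summed codeword of Λ by the recovery property, so its remaining
symbols can be subtracted from the sums of type Λ ∪ {θ}. The binomial theorem counts the sums, and
the count meets the converse bound.

Existence. The numbers α_k, β_k reduce to one integer sequence with prescribed consecutive sums.
Reed–Solomon codes over the extension of degree ℓ_k, read over F, are MDS array codes; Rado's
theorem selects independent vectors inside the thick columns, and bases extending them have the
recovery property. -/

namespace TPIR

/-! ### Entropy of partitions of a finite set -/

section PartEntropy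

variable {Ω : Type} [Fintype Ω]

open Classical in
/-- The number of elements of the class of `ω`. -/
noncomputable def classCard (r : Setoid Ω) (ω : Ω) : ℕ :=
  (Finset.univ.filter fun ω' => r ω ω').card

/-- The entropy of the class of a uniformly distributed element of `Ω`. -/
noncomputable def partEntropy (r : Setoid Ω) : ℝ :=
  Real.log (Fintype.card Ω) - (∑ ω, Real.log (classCard r ω)) / Fintype.card Ω

theorem classCard_pos (r : Setoid Ω) (ω : Ω) : 0 < classCard r ω :=
  Finset.card_pos.2 ⟨ω, by simp⟩

theorem classCard_congr {r : Setoid Ω} {ω ω' : Ω} (h : r ω ω') :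
    classCard r ω = classCard r ω' := by
  unfold classCard
  congr 1
  ext x
  simp only [Finset.mem_filter, Finset.mem_univ, true_and]
  exact ⟨fun hx => r.trans (r.symm h) hx, fun hx => r.trans h hx⟩

theorem classCard_mono {r s : Setoid Ω} (h : r ≤ s) (ω : Ω) : classCard r ω ≤ classCard s ω := by
  refine Finset.card_le_card fun x => ?_
  simp only [Finset.mem_filter, Finset.mem_univ, true_and]
  exact fun hx => h hx

theorem partEntropy_anti {r s : Setoid Ω} (h : r ≤ s) : partEntropy s ≤ partEntropy r := by
  unfold partEntropy
  gcongr with ω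
  · exact_mod_cast classCard_pos r ω
  · exact_mod_cast classCard_mono h ω

theorem partEntropy_top : partEntropy (⊤ : Setoid Ω) = 0 := by
  have h : ∀ ω : Ω, classCard ⊤ ω = Fintype.card Ω := fun ω => by
    simp [classCard, Setoid.top_def, Finset.card_univ]
  unfold partEntropy
  simp only [h, Finset.sum_const, Finset.card_univ, nsmul_eq_mul]
  rcases isEmpty_or_nonempty Ω with h0 | h0
  · simp
  · rw [mul_div_cancel_left₀, sub_self]
    exact_mod_cast Fintype.card_ne_zero

/-- Each class of `r` lies in a class of `s`; equality of the sums of logarithms forces equal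
cardinalities, hence equal classes. -/
theorem eq_of_partEntropy_eq {r s : Setoid Ω} (h : r ≤ s) (he : partEntropy r = partEntropy s) :
    r = s := by
  refine le_antisymm h fun x y hxy => ?_
  have : Nonempty Ω := ⟨x⟩
  have hc : (0 : ℝ) < Fintype.card Ω := by exact_mod_cast Fintype.card_pos
  have hle : ∀ ω ∈ Finset.univ, Real.log (classCard r ω) ≤ Real.log (classCard s ω) := fun ω _ =>
    Real.log_le_log (by exact_mod_cast classCard_pos r ω) (by exact_mod_cast classCard_mono h ω)
  have hs : ∑ ω, Real.log (classCard r ω) = ∑ ω, Real.log (classCard s ω) := by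
    unfold partEntropy at he
    field_simp at he
    linarith
  have hx := (Finset.sum_eq_sum_iff_of_le hle).1 hs x (Finset.mem_univ x)
  have hx' : classCard r x = classCard s x := by
    have := Real.log_injOn_pos (by simp [classCard_pos]) (by simp [classCard_pos]) hx
    exact_mod_cast this
  classical
  have hsub : (Finset.univ.filter fun ω' => r x ω') ⊆ Finset.univ.filter fun ω' => s x ω' := by
    intro z
    simp only [Finset.mem_filter, Finset.mem_univ, true_and]
    exact fun hz => h hz
  have heq := Finset.eq_of_subset_of_card_le hsub (by
    have := hx'.ge
    unfold classCard at this
    convert this)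
  have : y ∈ Finset.univ.filter fun ω' => s x ω' := by simpa using hxy
  rw [← heq] at this
  simpa using this

/-- Submodularity of the entropy of partitions. -/
theorem partEntropy_submodular {a b c : Setoid Ω} (ha : a ≤ c) (hb : b ≤ c) :
    partEntropy (a ⊓ b) + partEntropy c ≤ partEntropy a + partEntropy b := by
  classical
  rcases isEmpty_or_nonempty Ω with h0 | h0
  · simp [partEntropy]
  have hc : (0 : ℝ) < Fintype.card Ω := by exact_mod_cast Fintype.card_pos
  have pos : ∀ (r : Setoid Ω) (ω : Ω), (0 : ℝ) < classCard r ω := fun r ω => by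
    exact_mod_cast classCard_pos r ω
  have hcard : ∀ (r : Setoid Ω) (ω : Ω), (classCard r ω : ℝ) = ∑ ω', if r ω ω' then 1 else 0 := by
    intro r ω
    rw [Finset.sum_boole]
    unfold classCard
    congr!
  -- the key estimate
  have key : ∑ ω, (classCard a ω * classCard b ω : ℝ) / (classCard (a ⊓ b) ω * classCard c ω) ≤
      Fintype.card Ω := by
    have h1 : ∀ ω, (classCard a ω * classCard b ω : ℝ) / (classCard (a ⊓ b) ω * classCard c ω) =
        ∑ x, ∑ y, if a ω x ∧ b ω y then
          1 / ((classCard (a ⊓ b) ω : ℝ) * classCard c ω) else 0 := by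
      intro ω
      rw [hcard a, hcard b, Finset.sum_mul_sum, Finset.sum_div]
      refine Finset.sum_congr rfl fun x _ => ?_
      rw [Finset.sum_div]
      refine Finset.sum_congr rfl fun y _ => ?_
      by_cases h1 : a ω x <;> by_cases h2 : b ω y <;> simp [h1, h2]
    -- For a fixed pair (x, y), the points related to x by `a` and to y by `b` form either no class
    -- or exactly one class of `a ⊓ b`, on which the summand is constant; moreover x and y are then
    -- related by `c`.
    have h2 : ∀ x y, (∑ ω, if a ω x ∧ b ω y then
          1 / ((classCard (a ⊓ b) ω : ℝ) * classCard c ω) else 0) ≤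
        if c x y then 1 / (classCard c x : ℝ) else 0 := by
      intro x y
      by_cases hex : ∃ ω, a ω x ∧ b ω y
      · obtain ⟨ω₀, hx, hy⟩ := hex
        have hxy : c x y := c.trans (c.symm (ha hx)) (hb hy)
        rw [if_pos hxy]
        have hiff : ∀ ω, (a ω x ∧ b ω y) ↔ (a ⊓ b) ω₀ ω := by
          intro ω
          change _ ↔ a ω₀ ω ∧ b ω₀ ω
          exact ⟨fun h => ⟨a.trans hx (a.symm h.1), b.trans hy (b.symm h.2)⟩,
            fun h => ⟨a.trans (a.symm h.1) hx, b.trans (b.symm h.2) hy⟩⟩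
        have : ∀ ω, (if a ω x ∧ b ω y then
            1 / ((classCard (a ⊓ b) ω : ℝ) * classCard c ω) else 0) =
            (if (a ⊓ b) ω₀ ω then 1 else 0) *
              (1 / ((classCard (a ⊓ b) ω₀ : ℝ) * classCard c x)) := by
          intro ω
          by_cases h : (a ⊓ b) ω₀ ω
          · have h' := (hiff ω).2 h
            rw [if_pos h', if_pos h, one_mul, classCard_congr h, classCard_congr (ha h'.1)]
          · rw [if_neg h, if_neg (fun h' => h ((hiff ω).1 h')), zero_mul]
        simp only [this]
        rw [← Finset.sum_mul, ← hcard]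
        have := pos (a ⊓ b) ω₀
        have := pos c x
        apply le_of_eq
        field_simp
      · have h3 : ∀ ω, ¬ (a ω x ∧ b ω y) := fun ω h => hex ⟨ω, h⟩
        simp only [h3, if_false, Finset.sum_const_zero]
        split_ifs <;> positivity
    calc _ = ∑ x, ∑ y, ∑ ω, (if a ω x ∧ b ω y then
          1 / ((classCard (a ⊓ b) ω : ℝ) * classCard c ω) else 0) := by
          simp only [h1]
          rw [Finset.sum_comm]
          refine Finset.sum_congr rfl fun x _ => Finset.sum_comm
      _ ≤ ∑ x, ∑ y, if c x y then 1 / (classCard c x : ℝ) else 0 :=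
          Finset.sum_le_sum fun x _ => Finset.sum_le_sum fun y _ => h2 x y
      _ = ∑ x : Ω, (1 : ℝ) := by
          refine Finset.sum_congr rfl fun x _ => ?_
          have : ∀ y, (if c x y then 1 / (classCard c x : ℝ) else 0) =
              (if c x y then 1 else 0) * (1 / (classCard c x : ℝ)) := by intro y; simp
          simp only [this]
          rw [← Finset.sum_mul, ← hcard]
          have := pos c x
          field_simp
      _ = Fintype.card Ω := by simp
  -- The inequality log x ≤ x - 1 for the ratio in `key`, whose sum over ω is at most |Ω|.
  have hlog : ∀ ω, Real.log (classCard a ω) + Real.log (classCard b ω) -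
      Real.log (classCard (a ⊓ b) ω) - Real.log (classCard c ω) ≤
      (classCard a ω * classCard b ω : ℝ) / (classCard (a ⊓ b) ω * classCard c ω) - 1 := by
    intro ω
    have h1 := pos a ω
    have h2 := pos b ω
    have h3 := pos (a ⊓ b) ω
    have h4 := pos c ω
    have := Real.log_le_sub_one_of_pos
      (show 0 < (classCard a ω * classCard b ω : ℝ) / (classCard (a ⊓ b) ω * classCard c ω) by
        positivity)
    rw [Real.log_div (by positivity) (by positivity), Real.log_mul h1.ne' h2.ne',
      Real.log_mul h3.ne' h4.ne'] at this
    linarith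
  have hsum := Finset.sum_le_sum fun ω (_ : ω ∈ Finset.univ) => hlog ω
  simp only [Finset.sum_sub_distrib, Finset.sum_add_distrib, Finset.sum_const, Finset.card_univ,
    nsmul_eq_mul, mul_one] at hsum
  unfold partEntropy
  have : (∑ ω, Real.log (classCard a ω)) / (Fintype.card Ω : ℝ) +
      (∑ ω, Real.log (classCard b ω)) / Fintype.card Ω ≤
      (∑ ω, Real.log (classCard (a ⊓ b) ω)) / Fintype.card Ω +
      (∑ ω, Real.log (classCard c ω)) / Fintype.card Ω := by
    rw [← add_div, ← add_div]
    refine div_le_div_of_nonneg_right ?_ hc.le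
    linarith
  linarith

end PartEntropy

/-! ### Han's inequality -/

section Han

variable {ι : Type} [Fintype ι] [DecidableEq ι]

/-- A normalized submodular set function. -/
structure IsSubmodular (f : Finset ι → ℝ) : Prop where
  empty : f ∅ = 0
  submodular : ∀ A B, f (A ∪ B) + f (A ∩ B) ≤ f A + f B

namespace IsSubmodular

variable {f : Finset ι → ℝ} (hf : IsSubmodular f)
include hf

/-- Every coordinate of some point of the base polytope attains its maximal value. -/
theorem exists_base (i₀ : ι) : ∃ δ : ι → ℝ, δ i₀ = f {i₀} ∧ ∑ i, δ i = f Finset.univ ∧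
    ∀ Γ, ∑ i ∈ Γ, δ i ≤ f Γ := by
  have key : ∀ U : Finset ι, i₀ ∉ U → ∃ δ : ι → ℝ, δ i₀ = f {i₀} ∧
      ∑ i ∈ insert i₀ U, δ i = f (insert i₀ U) ∧ ∀ Γ ⊆ insert i₀ U, ∑ i ∈ Γ, δ i ≤ f Γ := by
    intro U
    induction U using Finset.induction_on with
    | empty =>
      intro _
      refine ⟨fun _ => f {i₀}, rfl, by simp, fun Γ hΓ => ?_⟩
      rcases Finset.subset_singleton_iff.1 (by simpa using hΓ) with rfl | rfl
      · simp [hf.empty]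
      · simp
    | insert a U ha ih =>
      intro hi
      simp only [Finset.mem_insert, not_or] at hi
      obtain ⟨δ, h0, h1, h2⟩ := ih hi.2
      have haU : a ∉ insert i₀ U := by simp [Ne.symm hi.1, ha]
      set V := insert i₀ U with hV
      have hVa : insert i₀ (insert a U) = insert a V := by rw [hV, Finset.insert_comm]
      rw [hVa]
      have hupd : ∀ Γ, a ∉ Γ → ∑ i ∈ Γ, Function.update δ a (f (insert a V) - f V) i =
          ∑ i ∈ Γ, δ i := fun Γ hΓ =>
        Finset.sum_congr rfl fun i hi => Function.update_of_ne (ne_of_mem_of_not_mem hi hΓ) _ _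
      -- The greedy algorithm: each new element gets its marginal value. Since `i₀` comes first, it
      -- gets the full `f {i₀}`.
      refine ⟨Function.update δ a (f (insert a V) - f V), ?_, ?_, fun Γ hΓ => ?_⟩
      · rw [Function.update_of_ne hi.1, h0]
      · rw [Finset.sum_insert haU, hupd V haU, h1, Function.update_self]
        ring
      · by_cases haΓ : a ∈ Γ
        · have hE : Γ.erase a ⊆ V := by
            intro x hx
            have := hΓ (Finset.mem_of_mem_erase hx)
            exact (Finset.mem_insert.1 this).resolve_left (Finset.ne_of_mem_erase hx)
          rw [← Finset.add_sum_erase _ _ haΓ, hupd _ (Finset.notMem_erase a Γ),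
            Function.update_self]
          have h3 := h2 _ hE
          have h4 := hf.submodular Γ V
          have h5 : Γ ∪ V = insert a V := by
            ext x
            simp only [Finset.mem_union, Finset.mem_insert]
            constructor
            · rintro (h | h)
              · simpa using hΓ h
              · exact Or.inr h
            · rintro (rfl | h)
              · exact Or.inl haΓ
              · exact Or.inr h
          have h6 : Γ ∩ V = Γ.erase a := by
            ext x
            simp only [Finset.mem_inter, Finset.mem_erase]
            constructor
            · rintro ⟨h, h'⟩
              exact ⟨fun e => haU (e ▸ h'), h⟩
            · rintro ⟨h, h'⟩
              exact ⟨h', hE (Finset.mem_erase.2 ⟨h, h'⟩)⟩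
          rw [h5, h6] at h4
          linarith
        · rw [hupd Γ haΓ]
          refine h2 Γ fun x hx => (Finset.mem_insert.1 (hΓ hx)).resolve_left ?_
          rintro rfl
          exact haΓ hx
  obtain ⟨δ, h0, h1, h2⟩ := key (Finset.univ.erase i₀) (Finset.notMem_erase _ _)
  rw [Finset.insert_erase (Finset.mem_univ _)] at h1 h2
  exact ⟨δ, h0, h1, fun Γ => h2 Γ (Finset.subset_univ _)⟩

omit hf in
theorem sum_powersetCard (δ : ι → ℝ) {T : ℕ} (hT : 1 ≤ T) :
    ∑ Γ ∈ Finset.univ.powersetCard T, ∑ i ∈ Γ, δ i =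
      (Fintype.card ι - 1).choose (T - 1) * ∑ i, δ i := by
  have h1 : ∀ i : ι, ((Finset.univ.powersetCard T).filter fun Γ : Finset ι => i ∈ Γ).card =
      (Fintype.card ι - 1).choose (T - 1) := by
    intro i
    rw [← Finset.card_univ, ← Finset.card_erase_of_mem (Finset.mem_univ i),
      ← Finset.card_powersetCard]
    refine Finset.card_bij' (fun Γ _ => Γ.erase i) (fun Γ _ => insert i Γ) ?_ ?_ ?_ ?_
    · intro Γ hΓ
      simp only [Finset.mem_filter, Finset.mem_powersetCard] at hΓ ⊢
      exact ⟨Finset.erase_subset_erase _ (Finset.subset_univ _),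
        by rw [Finset.card_erase_of_mem hΓ.2, hΓ.1.2]⟩
    · intro Γ hΓ
      simp only [Finset.mem_filter, Finset.mem_powersetCard] at hΓ ⊢
      have hi : i ∉ Γ := fun h => by simpa using hΓ.1 h
      refine ⟨⟨Finset.subset_univ _, by rw [Finset.card_insert_of_notMem hi, hΓ.2]; omega⟩,
        Finset.mem_insert_self _ _⟩
    · intro Γ hΓ
      exact Finset.insert_erase (Finset.mem_filter.1 hΓ).2
    · intro Γ hΓ
      have hi : i ∉ Γ := fun h => by simpa using (Finset.mem_powersetCard.1 hΓ).1 h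
      exact Finset.erase_insert hi
  calc _ = ∑ Γ ∈ Finset.univ.powersetCard T, ∑ i, if i ∈ Γ then δ i else 0 := by
        refine Finset.sum_congr rfl fun Γ _ => ?_
        rw [Finset.sum_ite_mem, Finset.univ_inter]
    _ = ∑ i, ∑ Γ ∈ Finset.univ.powersetCard T, if i ∈ Γ then δ i else 0 := Finset.sum_comm
    _ = _ := by
        rw [Finset.mul_sum]
        refine Finset.sum_congr rfl fun i _ => ?_
        rw [← Finset.sum_filter, Finset.sum_const, h1, nsmul_eq_mul]

/-- Han's inequality. -/
theorem han {T : ℕ} (hT : 1 ≤ T) : (Fintype.card ι - 1).choose (T - 1) * f Finset.univ ≤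
    ∑ Γ ∈ Finset.univ.powersetCard T, f Γ := by
  rcases isEmpty_or_nonempty ι with h | ⟨⟨i₀⟩⟩
  · have hu : (Finset.univ : Finset ι) = ∅ := by simp
    rw [hu, hf.empty, mul_zero]
    refine Finset.sum_nonneg fun Γ _ => ?_
    rw [Finset.eq_empty_of_isEmpty Γ, hf.empty]
  · obtain ⟨δ, -, h1, h2⟩ := hf.exists_base i₀
    rw [← h1, ← sum_powersetCard δ hT]
    exact Finset.sum_le_sum fun Γ _ => h2 Γ

-- Two T-sets that differ by exchanging i for j show that δ - ε is constant on S; its sum over one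
-- T-set is T times that constant, and it vanishes.
omit hf [Fintype ι] in
theorem eq_of_sum_eq {T : ℕ} {S : Finset ι} (hT : 1 ≤ T) (hTN : T < S.card) {δ ε : ι → ℝ}
    (h : ∀ Γ ⊆ S, Γ.card = T → ∑ i ∈ Γ, δ i = ∑ i ∈ Γ, ε i) : ∀ i ∈ S, δ i = ε i := by
  have hconst : ∀ i ∈ S, ∀ j ∈ S, δ i - ε i = δ j - ε j := by
    intro i hi j hj
    by_cases hij : i = j
    · rw [hij]
    obtain ⟨B, hB, hBc⟩ := Finset.exists_subset_card_eq (s := (S.erase i).erase j) (n := T - 1) (by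
      rw [Finset.card_erase_of_mem (by simp [Ne.symm hij, hj]), Finset.card_erase_of_mem hi]
      omega)
    have hBS : ∀ x ∈ B, x ∈ S := fun x hx =>
      Finset.mem_of_mem_erase (Finset.mem_of_mem_erase (hB hx))
    have hiB : i ∉ B := fun h => by simpa using hB h
    have hjB : j ∉ B := fun h => by simpa using hB h
    have e1 := h (insert i B) (Finset.insert_subset hi hBS)
      (by rw [Finset.card_insert_of_notMem hiB]; omega)
    have e2 := h (insert j B) (Finset.insert_subset hj hBS)
      (by rw [Finset.card_insert_of_notMem hjB]; omega)
    rw [Finset.sum_insert hiB, Finset.sum_insert hiB] at e1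
    rw [Finset.sum_insert hjB, Finset.sum_insert hjB] at e2
    linarith
  intro i hi
  obtain ⟨Γ, hΓ, hc⟩ := Finset.exists_subset_card_eq (s := S) (n := T) hTN.le
  have h1 := h Γ hΓ hc
  have h2 : ∑ j ∈ Γ, (δ j - ε j) = T * (δ i - ε i) := by
    rw [Finset.sum_congr rfl fun j hj => hconst j (hΓ hj) i hi, Finset.sum_const, hc,
      nsmul_eq_mul]
  rw [Finset.sum_sub_distrib, h1, sub_self] at h2
  have : (T : ℝ) ≠ 0 := by positivity
  have := (mul_eq_zero.1 h2.symm).resolve_left this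
  linarith

/-- The case of equality in Han's inequality. -/
theorem han_eq {T : ℕ} (hT : 1 ≤ T) (hTN : T < Fintype.card ι)
    (h : ∑ Γ ∈ Finset.univ.powersetCard T, f Γ =
      (Fintype.card ι - 1).choose (T - 1) * f Finset.univ) :
    f Finset.univ = ∑ i, f {i} ∧ ∀ Γ : Finset ι, Γ.card = T → f Γ = ∑ i ∈ Γ, f {i} := by
  have hmod : ∀ δ : ι → ℝ, ∑ i, δ i = f Finset.univ → (∀ Γ, ∑ i ∈ Γ, δ i ≤ f Γ) →
      ∀ Γ : Finset ι, Γ.card = T → f Γ = ∑ i ∈ Γ, δ i := by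
    intro δ h1 h2 Γ hΓ
    rw [← h1, ← sum_powersetCard δ hT] at h
    exact ((Finset.sum_eq_sum_iff_of_le fun Γ _ => h2 Γ).1 h.symm Γ (by simp [hΓ])).symm
  -- One base point for each coordinate that it maximizes. At equality all of them agree with `f` on
  -- T-sets, so they coincide, and the common point has coordinates `f {i}`.
  choose δ h0 h1 h2 using hf.exists_base
  have hne : Nonempty ι := Fintype.card_pos_iff.1 (by omega)
  obtain ⟨i₀⟩ := hne
  have heq : ∀ i, δ i₀ i = f {i} := by
    intro i
    rw [← h0 i]
    refine eq_of_sum_eq (S := Finset.univ) hT (by simpa [Finset.card_univ] using hTN)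
      (fun Γ _ hΓ => ?_) i (Finset.mem_univ i)
    rw [← hmod _ (h1 i₀) (h2 i₀) Γ hΓ, ← hmod _ (h1 i) (h2 i) Γ hΓ]
  refine ⟨?_, fun Γ hΓ => ?_⟩
  · rw [← h1 i₀]
    exact Finset.sum_congr rfl fun i _ => heq i
  · rw [hmod _ (h1 i₀) (h2 i₀) Γ hΓ]
    exact Finset.sum_congr rfl fun i _ => heq i

theorem le_sum_singleton : f Finset.univ ≤ ∑ i, f {i} := by
  rcases isEmpty_or_nonempty ι with h | ⟨⟨i₀⟩⟩
  · have hu : (Finset.univ : Finset ι) = ∅ := by simp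
    rw [hu, hf.empty, Finset.sum_empty]
  · obtain ⟨δ, -, h1, h2⟩ := hf.exists_base i₀
    rw [← h1]
    exact Finset.sum_le_sum fun i _ => by simpa using h2 {i}

end IsSubmodular

end Han

/-! ### Averages and entropies of finite distributions -/

section Pmf

variable {A B C : Type}

/-- The mean of `g` under `p`. -/
noncomputable def mean (p : PMF A) (g : A → ℝ) : ℝ := ∑' a, (p a).toReal * g a

theorem mean_eq_sum [Fintype A] (p : PMF A) (g : A → ℝ) :
    mean p g = ∑ a, (p a).toReal * g a := tsum_fintype _

theorem sum_toReal [Fintype A] (p : PMF A) : ∑ a, (p a).toReal = 1 := by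
  rw [← ENNReal.toReal_sum fun a _ => p.apply_ne_top a, ← tsum_fintype (L := .unconditional A),
    p.tsum_coe, ENNReal.toReal_one]

theorem toReal_pos_iff (p : PMF A) (a : A) : 0 < (p a).toReal ↔ a ∈ p.support := by
  rw [PMF.mem_support_iff, ENNReal.toReal_pos_iff, pos_iff_ne_zero]
  exact ⟨fun h => h.1, fun h => ⟨h, (p.apply_ne_top a).lt_top⟩⟩

theorem toReal_ne_zero_iff (p : PMF A) (a : A) : (p a).toReal ≠ 0 ↔ a ∈ p.support := by
  rw [← toReal_pos_iff]
  exact ⟨fun h => lt_of_le_of_ne ENNReal.toReal_nonneg h.symm, fun h => h.ne'⟩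

section mean

variable [Finite A]

theorem mean_const (p : PMF A) (c : ℝ) : mean p (fun _ => c) = c := by
  have := Fintype.ofFinite A
  rw [mean_eq_sum, ← Finset.sum_mul, sum_toReal, one_mul]

theorem mean_add (p : PMF A) (f g : A → ℝ) :
    mean p (fun a => f a + g a) = mean p f + mean p g := by
  have := Fintype.ofFinite A
  simp only [mean_eq_sum, mul_add, Finset.sum_add_distrib]

theorem mean_const_mul (p : PMF A) (c : ℝ) (f : A → ℝ) :
    mean p (fun a => c * f a) = c * mean p f := by
  have := Fintype.ofFinite A
  simp only [mean_eq_sum, Finset.mul_sum]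
  exact Finset.sum_congr rfl fun _ _ => by ring

theorem mean_sum {ι : Type} (s : Finset ι) (p : PMF A) (f : ι → A → ℝ) :
    mean p (fun a => ∑ i ∈ s, f i a) = ∑ i ∈ s, mean p (f i) := by
  have := Fintype.ofFinite A
  simp only [mean_eq_sum, Finset.mul_sum]
  exact Finset.sum_comm

theorem mean_mono {p : PMF A} {f g : A → ℝ} (h : ∀ a ∈ p.support, f a ≤ g a) :
    mean p f ≤ mean p g := by
  have := Fintype.ofFinite A
  simp only [mean_eq_sum]
  refine Finset.sum_le_sum fun a _ => ?_
  by_cases ha : a ∈ p.support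
  · exact mul_le_mul_of_nonneg_left (h a ha) ENNReal.toReal_nonneg
  · rw [not_not.1 (mt (toReal_ne_zero_iff p a).1 ha), zero_mul, zero_mul]

theorem mean_congr {p : PMF A} {f g : A → ℝ} (h : ∀ a ∈ p.support, f a = g a) :
    mean p f = mean p g :=
  le_antisymm (mean_mono fun a ha => (h a ha).le) (mean_mono fun a ha => (h a ha).ge)

theorem eq_of_mean_eq {p : PMF A} {f g : A → ℝ} (h : ∀ a ∈ p.support, f a ≤ g a)
    (he : mean p f = mean p g) : ∀ a ∈ p.support, f a = g a := by
  have := Fintype.ofFinite A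
  simp only [mean_eq_sum] at he
  intro a ha
  have hle : ∀ a ∈ Finset.univ, (p a).toReal * f a ≤ (p a).toReal * g a := by
    intro a _
    by_cases ha : a ∈ p.support
    · exact mul_le_mul_of_nonneg_left (h a ha) ENNReal.toReal_nonneg
    · rw [not_not.1 (mt (toReal_ne_zero_iff p a).1 ha), zero_mul, zero_mul]
  have := (Finset.sum_eq_sum_iff_of_le hle).1 he a (Finset.mem_univ a)
  exact mul_left_cancel₀ ((toReal_ne_zero_iff p a).2 ha) this

theorem toReal_bind (p : PMF A) (f : A → PMF B) (b : B) :
    ((p.bind f) b).toReal = mean p fun a => (f a b).toReal := by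
  have := Fintype.ofFinite A
  rw [PMF.bind_apply, tsum_fintype, ENNReal.toReal_sum, mean_eq_sum]
  · simp only [ENNReal.toReal_mul]
  · exact fun a _ => ENNReal.mul_ne_top (p.apply_ne_top a) ((f a).apply_ne_top b)

theorem mean_map [Finite B] (p : PMF A) (f : A → B) (g : B → ℝ) :
    mean (p.map f) g = mean p (g ∘ f) := by
  classical
  have := Fintype.ofFinite A
  have := Fintype.ofFinite B
  have h : ∀ b, ((p.map f) b).toReal = ∑ a, if b = f a then (p a).toReal else 0 := by
    intro b
    rw [PMF.map_apply, tsum_fintype, ENNReal.toReal_sum]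
    · exact Finset.sum_congr rfl fun a _ => by split_ifs <;> simp
    · intro a _
      split_ifs
      · exact p.apply_ne_top a
      · simp
  simp only [mean_eq_sum, h, Finset.sum_mul, ite_mul, zero_mul]
  rw [Finset.sum_comm]
  simp

end mean

/-- The entropy of a distribution. -/
noncomputable def pmfEntropy (p : PMF A) : ℝ := ∑' a, Real.negMulLog (p a).toReal

theorem entropy_def (p : PMF A) (X : A → B) : entropy p X = pmfEntropy (p.map X) := rfl

theorem pmfEntropy_eq_sum [Fintype A] (p : PMF A) :
    pmfEntropy p = ∑ a, Real.negMulLog (p a).toReal := tsum_fintype _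

theorem map_apply_of_injective {f : A → B} (hf : f.Injective) (p : PMF A) (a : A) :
    p.map f (f a) = p a := by
  rw [PMF.map_apply, tsum_eq_single a]
  · simp
  · intro a' ha
    rw [if_neg]
    exact fun h => ha (hf h).symm

theorem pmfEntropy_map {f : A → B} (hf : f.Injective) (p : PMF A) :
    pmfEntropy (p.map f) = pmfEntropy p := by
  unfold pmfEntropy
  rw [← hf.tsum_eq]
  · simp only [map_apply_of_injective hf]
  · intro b hb
    by_contra hr
    apply hb
    have : p.map f b = 0 := by
      by_contra h0
      obtain ⟨a, -, ha⟩ := (PMF.mem_support_map_iff f p b).1 ((PMF.mem_support_iff _ _).2 h0)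
      exact hr ⟨a, ha⟩
    simp [this]

theorem mean_pmfEntropy_le [Finite A] [Finite B] (p : PMF A) (f : A → PMF B) :
    mean p (fun a => pmfEntropy (f a)) ≤ pmfEntropy (p.bind f) := by
  have := Fintype.ofFinite A
  have := Fintype.ofFinite B
  simp only [pmfEntropy_eq_sum, toReal_bind, mean_sum]
  refine Finset.sum_le_sum fun b _ => ?_
  simp only [mean_eq_sum]
  exact Real.concaveOn_negMulLog.le_map_sum (fun _ _ => ENNReal.toReal_nonneg) (sum_toReal p)
    fun _ _ => ENNReal.toReal_nonneg

/-- Equality in Jensen's inequality for the strictly concave function -x log x. It serves twice: for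
privacy, and for answers of tight schemes. -/
theorem eq_of_pmfEntropy_bind [Finite A] [Finite B] {p : PMF A} {f : A → PMF B}
    (h : mean p (fun a => pmfEntropy (f a)) = pmfEntropy (p.bind f)) :
    ∀ a ∈ p.support, ∀ a' ∈ p.support, f a = f a' := by
  have := Fintype.ofFinite A
  have := Fintype.ofFinite B
  simp only [pmfEntropy_eq_sum, toReal_bind, mean_sum] at h
  simp only [mean_eq_sum] at h
  have hle : ∀ b ∈ Finset.univ, ∑ a, (p a).toReal * Real.negMulLog (f a b).toReal ≤
      Real.negMulLog (∑ a, (p a).toReal * (f a b).toReal) := fun b _ =>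
    Real.concaveOn_negMulLog.le_map_sum (fun _ _ => ENNReal.toReal_nonneg) (sum_toReal p)
      fun _ _ => ENNReal.toReal_nonneg
  rw [Finset.sum_eq_sum_iff_of_le hle] at h
  intro a ha a' ha'
  ext b
  have hb := (Real.strictConcaveOn_negMulLog.map_sum_eq_iff_of_nonneg
    (fun _ _ => ENNReal.toReal_nonneg) (sum_toReal p)
      fun a _ => (ENNReal.toReal_nonneg : 0 ≤ (f a b).toReal)).1 (h b (Finset.mem_univ b)).symm
    (Finset.mem_univ a) ((toReal_ne_zero_iff p a).2 ha) (Finset.mem_univ a')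
    ((toReal_ne_zero_iff p a').2 ha')
  exact (ENNReal.toReal_eq_toReal_iff' ((f a).apply_ne_top b) ((f a').apply_ne_top b)).1 hb

theorem pmfEntropy_chain [Finite A] [Finite B] (p : PMF A) (f : A → PMF B) :
    pmfEntropy (p.bind fun a => (f a).map (Prod.mk a)) =
      pmfEntropy p + mean p fun a => pmfEntropy (f a) := by
  classical
  have := Fintype.ofFinite A
  have := Fintype.ofFinite B
  have h : ∀ a b, ((p.bind fun a => (f a).map (Prod.mk a)) (a, b)).toReal =
      (p a).toReal * (f a b).toReal := by
    intro a b
    rw [toReal_bind, mean_eq_sum, Finset.sum_eq_single a]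
    · rw [map_apply_of_injective (Prod.mk_right_injective a)]
    · intro a' _ ha
      have : ((f a').map (Prod.mk a')) (a, b) = 0 := by
        by_contra h0
        obtain ⟨b', -, hb⟩ :=
          (PMF.mem_support_map_iff _ _ _).1 ((PMF.mem_support_iff _ _).2 h0)
        exact ha (Prod.ext_iff.1 hb).1
      rw [this, ENNReal.toReal_zero, mul_zero]
    · simp
  simp only [pmfEntropy_eq_sum, mean_eq_sum, Fintype.sum_prod_type, h, Real.negMulLog_mul,
    Finset.sum_add_distrib, ← Finset.sum_mul, sum_toReal, one_mul, Finset.mul_sum]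

theorem pmfEntropy_le_log_card [Fintype A] (p : PMF A) :
    pmfEntropy p ≤ Real.log (Fintype.card A) := by
  have hne : Nonempty A := p.support_nonempty.to_type
  have hc : (0 : ℝ) < Fintype.card A := by exact_mod_cast Fintype.card_pos
  have h := Real.concaveOn_negMulLog.le_map_sum (t := Finset.univ)
    (w := fun _ : A => (Fintype.card A : ℝ)⁻¹) (p := fun a => (p a).toReal)
    (fun _ _ => by positivity) (by simp [Finset.card_univ, hc.ne'])
    fun _ _ => ENNReal.toReal_nonneg
  simp only [smul_eq_mul, ← Finset.mul_sum, sum_toReal, mul_one] at h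
  rw [pmfEntropy_eq_sum]
  unfold Real.negMulLog at h ⊢
  rw [Real.log_inv] at h
  field_simp at h
  simpa [neg_mul] using h

/-- Only the partition into fibres matters for a function of uniform records. This lets the converse
work with `Setoid`s, where joint variables are infima. -/
theorem pmfEntropy_uniform_map {Ω : Type} [Fintype Ω] [Nonempty Ω] [Finite B] (f : Ω → B) :
    pmfEntropy ((PMF.uniformOfFintype Ω).map f) = partEntropy (Setoid.ker f) := by
  classical
  have := Fintype.ofFinite B
  have hc : (0 : ℝ) < Fintype.card Ω := by exact_mod_cast Fintype.card_pos
  have hfib : ∀ b, (((PMF.uniformOfFintype Ω).map f) b).toReal =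
      ((Finset.univ.filter fun ω => f ω = b).card : ℝ) / Fintype.card Ω := by
    intro b
    rw [PMF.map_apply, tsum_fintype, ENNReal.toReal_sum]
    · rw [Finset.card_filter, Nat.cast_sum, Finset.sum_div]
      refine Finset.sum_congr rfl fun ω _ => ?_
      by_cases h : b = f ω
      · simp [h]
      · simp [h, Ne.symm h]
    · intro ω _
      split_ifs <;> simp
  have hcl : ∀ ω, classCard (Setoid.ker f) ω = (Finset.univ.filter fun ω' => f ω' = f ω).card := by
    intro ω
    unfold classCard
    congr 1
    ext ω'
    simp [Setoid.ker_def, eq_comm]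
  rw [pmfEntropy_eq_sum]
  simp only [hfib]
  unfold partEntropy
  have h1 : ∀ b, Real.negMulLog (((Finset.univ.filter fun ω => f ω = b).card : ℝ) /
      Fintype.card Ω) = ∑ ω ∈ Finset.univ.filter (fun ω => f ω = b),
        (Real.log (Fintype.card Ω) - Real.log (classCard (Setoid.ker f) ω)) / Fintype.card Ω := by
    intro b
    have h2 : ∀ ω ∈ Finset.univ.filter (fun ω => f ω = b),
        (Real.log (Fintype.card Ω) - Real.log (classCard (Setoid.ker f) ω)) / Fintype.card Ω =
        (Real.log (Fintype.card Ω) - Real.log (Finset.univ.filter fun ω => f ω = b).card) /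
          Fintype.card Ω := by
      intro ω hω
      rw [hcl, (Finset.mem_filter.1 hω).2]
    rw [Finset.sum_congr rfl h2, Finset.sum_const, nsmul_eq_mul, Real.negMulLog]
    by_cases h0 : (Finset.univ.filter fun ω => f ω = b).card = 0
    · simp [h0]
    · rw [Real.log_div (by exact_mod_cast h0) hc.ne']
      ring
  simp only [h1]
  refine (Finset.sum_fiberwise Finset.univ f _).trans ?_
  rw [← Finset.sum_div, Finset.sum_sub_distrib, sub_div]
  simp [Finset.card_univ, hc.ne']

end Pmf

/-! ### Correctness and privacy in terms of the queries -/

namespace Scheme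

variable {F : Type} {N M L : ℕ} [Field F] [Fintype F] (S : Scheme F N M L)

instance : Finite S.Seed := S.finiteSeed
instance (i : Fin N) : Finite (S.Query i) := S.finiteQuery i
instance (i : Fin N) : Finite (S.Ans i) := S.finiteAns i

theorem law_map {A : Type} (X : S.Seed × Records F M L → A) : S.law.map X =
    S.seedLaw.bind fun s =>
      (PMF.uniformOfFintype (Records F M L)).map fun W => X (s, W) := by
  rw [law, PMF.map_bind]
  simp only [PMF.map_comp]
  rfl

/-- By the chain rule both entropies are H(S) plus a mean over seeds of partition entropies;
adjoining W_θ refines the partition, so equality of the means forces equality of the partitions at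
every seed of positive probability. -/
theorem isCorrect_iff : S.IsCorrect ↔ ∀ θ, ∀ s ∈ S.seedLaw.support, ∀ W W' : Records F M L,
    (∀ i, S.answer θ s W i = S.answer θ s W' i) → W θ = W' θ := by
  refine forall_congr' fun θ => ?_
  let a : S.Seed → Records F M L → ∀ i, S.Ans i := fun s W i => S.answer θ s W i
  have h1 : entropy S.law (fun ω => (ω.2 θ,
      ((fun i : Fin N => S.answer θ ω.1 ω.2 i), S.que θ ω.1, ω.1))) =
      pmfEntropy S.seedLaw + mean S.seedLaw fun s =>
        partEntropy (Setoid.ker fun W : Records F M L => (W θ, a s W)) := by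
    simp only [← pmfEntropy_uniform_map]
    rw [← pmfEntropy_chain, ← pmfEntropy_map (f := fun z : S.Seed × (Fin L → F) × ∀ i, S.Ans i =>
      (z.2.1, (z.2.2, S.que θ z.1, z.1)))]
    · rw [entropy_def, law_map, PMF.map_bind]
      simp only [PMF.map_comp]
      rfl
    · rintro ⟨s, x, y⟩ ⟨s', x', y'⟩ h
      simp only [Prod.mk.injEq] at h ⊢
      tauto
  have h2 : entropy S.law (fun ω =>
      ((fun i : Fin N => S.answer θ ω.1 ω.2 i), S.que θ ω.1, ω.1)) =
      pmfEntropy S.seedLaw + mean S.seedLaw fun s => partEntropy (Setoid.ker (a s)) := by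
    simp only [← pmfEntropy_uniform_map]
    rw [← pmfEntropy_chain, ← pmfEntropy_map (f := fun z : S.Seed × ∀ i, S.Ans i =>
      (z.2, S.que θ z.1, z.1))]
    · rw [entropy_def, law_map, PMF.map_bind]
      simp only [PMF.map_comp]
      rfl
    · rintro ⟨s, y⟩ ⟨s', y'⟩ h
      simp only [Prod.mk.injEq] at h ⊢
      tauto
  have hle : ∀ s, Setoid.ker (fun W : Records F M L => (W θ, a s W)) ≤ Setoid.ker (a s) := by
    intro s W W' h
    exact (Prod.ext_iff.1 h).2
  rw [condEntropy, h1, h2, add_sub_add_left_eq_sub, sub_eq_zero]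
  constructor
  · intro h s hs W W' hW
    have := eq_of_partEntropy_eq (hle s)
      (eq_of_mean_eq (fun s _ => partEntropy_anti (hle s)) h.symm s hs).symm
    have hr : Setoid.ker (a s) W W' := funext hW
    rw [← this] at hr
    exact (Prod.ext_iff.1 hr).1
  · intro h
    refine mean_congr fun s hs => ?_
    congr 1
    refine le_antisymm (hle s) fun W W' hW => ?_
    exact Prod.ext (h s hs W W' fun i => congrFun hW i) hW

/-- The queries to the servers in `Γ`. -/
def queOn (Γ : Finset (Fin N)) (θ : Fin M) (s : S.Seed) (i : Γ) : S.Query i.1 := S.que θ s i.1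

/-- I(θ; Z) is the Jensen gap: the entropy of the mixture of the laws of Z minus their mean entropy.
-/
theorem mutualInfo_eq (Γ : Finset (Fin N)) (π : PMF (Fin M)) :
    mutualInfo (S.lawWithIndex π) (fun ω => ω.1)
      (fun ω => ((fun i : Γ => S.que ω.1 ω.2.1 i.1),
        (fun i : Γ => S.answer ω.1 ω.2.1 ω.2.2 i.1), ω.2.2)) =
    pmfEntropy (π.bind fun θ => S.law.map fun ω => (S.queOn Γ θ ω.1,
        (fun i : Γ => S.answer θ ω.1 ω.2 i.1), ω.2)) -
      mean π fun θ => pmfEntropy (S.law.map fun ω => (S.queOn Γ θ ω.1,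
        (fun i : Γ => S.answer θ ω.1 ω.2 i.1), ω.2)) := by
  have h1 : (S.lawWithIndex π).map (fun ω => ω.1) = π := by
    rw [lawWithIndex, PMF.map_bind]
    simp only [PMF.map_comp, Function.comp_def]
    have : ∀ θ : Fin M, S.law.map (fun _ => θ) = PMF.pure θ := fun θ => PMF.map_const _ _
    simp only [this, PMF.bind_pure]
  have h3 := pmfEntropy_chain π fun θ => S.law.map fun ω => (S.queOn Γ θ ω.1,
        (fun i : Γ => S.answer θ ω.1 ω.2 i.1), ω.2)
  rw [mutualInfo, entropy_def, h1, entropy_def, entropy_def, lawWithIndex, PMF.map_bind,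
    PMF.map_bind]
  simp only [PMF.map_comp, Function.comp_def] at h3 ⊢
  unfold queOn at h3 ⊢
  linarith

/-- The gap vanishes when all laws in the mixture agree, and for the uniform prior, which charges
every θ, only then. Answers and records add nothing, because the records are independent of the
queries and the answers are functions of both. -/
theorem isPrivate_iff {T : ℕ} : S.IsPrivate T ↔ ∀ Γ : Finset (Fin N), Γ.card = T → ∀ θ θ',
    S.seedLaw.map (S.queOn Γ θ) = S.seedLaw.map (S.queOn Γ θ') := by
  refine forall_congr' fun Γ => forall_congr' fun hΓ => ?_
  simp only [mutualInfo_eq, sub_eq_zero]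
  constructor
  · intro h θ θ'
    have : Nonempty (Fin M) := ⟨θ⟩
    have h1 := eq_of_pmfEntropy_bind (h (PMF.uniformOfFintype (Fin M))).symm θ
      (PMF.mem_support_uniformOfFintype θ) θ' (PMF.mem_support_uniformOfFintype θ')
    have h2 := congrArg (PMF.map Prod.fst) h1
    simp only [PMF.map_comp, Function.comp_def] at h2
    have h3 : ∀ θ, S.law.map (fun ω => S.queOn Γ θ ω.1) = S.seedLaw.map (S.queOn Γ θ) := by
      intro θ
      rw [law_map]
      have : ∀ s, (PMF.uniformOfFintype (Records F M L)).map (fun _ => S.queOn Γ θ s) =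
        PMF.pure (S.queOn Γ θ s) := fun s => PMF.map_const _ _
      simp only [this]
      rfl
    rwa [h3, h3] at h2
  · intro h π
    obtain ⟨θ₀, -⟩ := π.support_nonempty
    have h1 : ∀ θ, S.law.map (fun ω => (S.queOn Γ θ ω.1,
        (fun i : Γ => S.answer θ ω.1 ω.2 i.1), ω.2)) = S.law.map (fun ω => (S.queOn Γ θ₀ ω.1,
        (fun i : Γ => S.answer θ₀ ω.1 ω.2 i.1), ω.2)) := by
      have h2 : ∀ θ, S.law.map (fun ω => (S.queOn Γ θ ω.1,
        (fun i : Γ => S.answer θ ω.1 ω.2 i.1), ω.2)) = (S.seedLaw.map (S.queOn Γ θ)).bind fun q =>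
          (PMF.uniformOfFintype (Records F M L)).map fun W =>
            (q, (fun i : Γ => S.ans i.1 (q i) W), W) := by
        intro θ
        rw [law_map, PMF.bind_map]
        rfl
      intro θ
      rw [h2, h2, h θ θ₀]
    simp only [h1, mean_const, PMF.bind_const]

end Scheme

/-! ### The converse -/

section Linear

variable {F V U : Type} [Field F] [Fintype F] [AddCommGroup V] [Module F V] [Fintype V]
  [AddCommGroup U] [Module F U]

/-- All fibres are cosets of the kernel. This is where entropies of linear schemes become integer
multiples of log q. -/
theorem partEntropy_ker_linearMap (f : V →ₗ[F] U) : partEntropy (Setoid.ker f) =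
    Module.finrank F (LinearMap.range f) * Real.log (Fintype.card F) := by
  classical
  have : FiniteDimensional F V := Module.Finite.of_finite
  have hcl : ∀ v, classCard (Setoid.ker f) v =
      Fintype.card F ^ Module.finrank F (LinearMap.ker f) := by
    intro v
    rw [← Module.card_eq_pow_finrank (K := F) (V := LinearMap.ker f), Fintype.card_subtype]
    refine Finset.card_bij' (fun w _ => w - v) (fun w _ => w + v) ?_ ?_ ?_ ?_
    · intro w hw
      have : f v = f w := by simpa [Setoid.ker_def] using hw
      simp [this]
    · intro w hw
      have : f w = 0 := by simpa using hw
      simp [Setoid.ker_def, this]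
    · intro w _
      exact sub_add_cancel w v
    · intro w _
      exact add_sub_cancel_right w v
  have hV := Module.card_eq_pow_finrank (K := F) (V := V)
  have hc : (Fintype.card V : ℝ) ≠ 0 := by exact_mod_cast Fintype.card_ne_zero
  unfold partEntropy
  simp only [hcl, Finset.sum_const, Finset.card_univ, nsmul_eq_mul]
  rw [mul_div_cancel_left₀ _ hc, hV, ← f.finrank_range_add_finrank_ker]
  push_cast
  rw [Real.log_pow, Real.log_pow]
  push_cast
  ring

end Linear

theorem choose_mul_eq {N T : ℕ} (hT : 1 ≤ T) (hTN : T < N) :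
    (N - 1).choose (T - 1) * (N : ℝ) = T * N.choose T := by
  obtain ⟨n, rfl⟩ : ∃ n, N = n + 1 := ⟨N - 1, by omega⟩
  obtain ⟨t, rfl⟩ : ∃ t, T = t + 1 := ⟨T - 1, by omega⟩
  have := Nat.add_one_mul_choose_eq n t
  simp only [Nat.add_sub_cancel]
  rw [mul_comm, mul_comm ((t + 1 : ℕ) : ℝ)]
  exact_mod_cast this

namespace Scheme

variable {F : Type} {N M L : ℕ}

/-- Equality of the records in `Λ`. -/
def recRel (F : Type) {M : ℕ} (L : ℕ) (Λ : Finset (Fin M)) : Setoid (Records F M L) :=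
  Setoid.ker fun W (j : Λ) => W j

variable [Field F] [Fintype F] (S : Scheme F N M L)

theorem recRel_apply {Λ : Finset (Fin M)} {W W' : Records F M L} :
    recRel F L Λ W W' ↔ ∀ j ∈ Λ, W j = W' j := by
  exact ⟨fun h j hj => congrFun h ⟨j, hj⟩, fun h => funext fun j => h j.1 j.2⟩

theorem partEntropy_recRel (Λ : Finset (Fin M)) : partEntropy (recRel F L Λ) =
    (Λ.card * L : ℕ) * Real.log (Fintype.card F) := by
  have h := partEntropy_ker_linearMap
    (LinearMap.funLeft F (Fin L → F) (Subtype.val : Λ → Fin M))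
  have hs : LinearMap.range (LinearMap.funLeft F (Fin L → F) (Subtype.val : Λ → Fin M)) = ⊤ :=
    LinearMap.range_eq_top.2 (LinearMap.funLeft_surjective_of_injective _ _ _
      Subtype.val_injective)
  rw [hs, finrank_top] at h
  refine Eq.trans ?_ (h.trans ?_)
  · rfl
  · congr 2
    simp [Module.finrank_pi_fintype]

/-- Equality of the answers of the servers in `Γ`. -/
def ansRel (Γ : Finset (Fin N)) (q : ∀ i : Γ, S.Query i.1) : Setoid (Records F M L) :=
  Setoid.ker fun W (i : Γ) => S.ans i.1 (q i) W

theorem ansRel_apply {Γ : Finset (Fin N)} {q : ∀ i : Γ, S.Query i.1} {W W' : Records F M L} :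
    S.ansRel Γ q W W' ↔ ∀ i : Γ, S.ans i.1 (q i) W = S.ans i.1 (q i) W' := by
  exact ⟨fun h i => congrFun h i, fun h => funext h⟩

/-- The entropy of the answers to `q` of the servers in `Γ`, given the records in `Λ`. -/
noncomputable def ansEntropy (Λ : Finset (Fin M)) (Γ : Finset (Fin N))
    (q : ∀ i : Γ, S.Query i.1) : ℝ :=
  partEntropy (S.ansRel Γ q ⊓ recRel F L Λ) - partEntropy (recRel F L Λ)

/-- The entropy of the answers of the servers in `Γ`, given the records in `Λ`, when `θ` is
retrieved with the random resources `s`. -/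
noncomputable def cond (Λ : Finset (Fin M)) (θ : Fin M) (s : S.Seed) (Γ : Finset (Fin N)) : ℝ :=
  S.ansEntropy Λ Γ (S.queOn Γ θ s)

/-- The entropy of the answer to `x` of server `i`, given the records in `Λ`. -/
noncomputable def ansEntropyOne (Λ : Finset (Fin M)) (i : Fin N) (x : S.Query i) : ℝ :=
  partEntropy (Setoid.ker (S.ans i x) ⊓ recRel F L Λ) - partEntropy (recRel F L Λ)

theorem cond_singleton (Λ : Finset (Fin M)) (θ : Fin M) (s : S.Seed) (i : Fin N) :
    S.cond Λ θ s {i} = S.ansEntropyOne Λ i (S.que θ s i) := by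
  have : S.ansRel {i} (S.queOn {i} θ s) = Setoid.ker (S.ans i (S.que θ s i)) := by
    ext W W'
    rw [ansRel_apply, Setoid.ker_def]
    constructor
    · intro h
      exact h ⟨i, Finset.mem_singleton_self i⟩
    · rintro h ⟨j, hj⟩
      obtain rfl := Finset.mem_singleton.1 hj
      exact h
  rw [cond, ansEntropy, this, ansEntropyOne]

/-- Partition submodularity, with the answers of A ∩ B, refined by the records in Λ, as the common
coarsening. -/
theorem cond_isSubmodular (Λ : Finset (Fin M)) (θ : Fin M) (s : S.Seed) :
    IsSubmodular (S.cond Λ θ s) where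
  empty := by
    have : S.ansRel ∅ (S.queOn ∅ θ s) ⊓ recRel F L Λ = recRel F L Λ := by
      refine inf_eq_right.2 fun W W' _ => ?_
      rw [ansRel_apply]
      rintro ⟨i, hi⟩
      simp at hi
    rw [cond, ansEntropy, this, sub_self]
  submodular A B := by
    have h := partEntropy_submodular
      (a := S.ansRel A (S.queOn A θ s) ⊓ recRel F L Λ)
      (b := S.ansRel B (S.queOn B θ s) ⊓ recRel F L Λ)
      (c := S.ansRel (A ∩ B) (S.queOn (A ∩ B) θ s) ⊓ recRel F L Λ)
      (inf_le_inf_right _ fun W W' h => by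
        rw [ansRel_apply] at h ⊢
        exact fun i => h ⟨i.1, (Finset.mem_inter.1 i.2).1⟩)
      (inf_le_inf_right _ fun W W' h => by
        rw [ansRel_apply] at h ⊢
        exact fun i => h ⟨i.1, (Finset.mem_inter.1 i.2).2⟩)
    have he : S.ansRel A (S.queOn A θ s) ⊓ recRel F L Λ ⊓
        (S.ansRel B (S.queOn B θ s) ⊓ recRel F L Λ) =
        S.ansRel (A ∪ B) (S.queOn (A ∪ B) θ s) ⊓ recRel F L Λ := by
      rw [← inf_inf_distrib_right]
      congr 1
      ext W W'
      change (S.ansRel A _ W W' ∧ S.ansRel B _ W W') ↔ _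
      rw [ansRel_apply, ansRel_apply, ansRel_apply]
      constructor
      · rintro ⟨h1, h2⟩ ⟨i, hi⟩
        rcases Finset.mem_union.1 hi with h | h
        · exact h1 ⟨i, h⟩
        · exact h2 ⟨i, h⟩
      · exact fun h => ⟨fun i => h ⟨i.1, Finset.mem_union_left _ i.2⟩,
          fun i => h ⟨i.1, Finset.mem_union_right _ i.2⟩⟩
    rw [he] at h
    simp only [cond, ansEntropy]
    linarith

theorem cond_mono (Λ : Finset (Fin M)) (θ : Fin M) (s : S.Seed) {A B : Finset (Fin N)}
    (h : A ⊆ B) : S.cond Λ θ s A ≤ S.cond Λ θ s B := by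
  refine sub_le_sub_right (partEntropy_anti (inf_le_inf_right _ fun W W' hW => ?_)) _
  rw [ansRel_apply] at hW ⊢
  exact fun i => hW ⟨i.1, h i.2⟩

theorem cond_nonneg (Λ : Finset (Fin M)) (θ : Fin M) (s : S.Seed) (A : Finset (Fin N)) :
    0 ≤ S.cond Λ θ s A := by
  rw [← (S.cond_isSubmodular Λ θ s).empty]
  exact S.cond_mono Λ θ s (Finset.empty_subset A)

/-- Given all answers, W_θ is already determined, so conditioning on it leaves the joint partition
unchanged and only removes its own entropy L log q. -/
theorem cond_insert (hS : S.IsCorrect) {Λ : Finset (Fin M)} {θ : Fin M} (hθ : θ ∉ Λ)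
    {s : S.Seed} (hs : s ∈ S.seedLaw.support) : S.cond Λ θ s Finset.univ =
      L * Real.log (Fintype.card F) + S.cond (insert θ Λ) θ s Finset.univ := by
  have : S.ansRel Finset.univ (S.queOn Finset.univ θ s) ⊓ recRel F L (insert θ Λ) =
      S.ansRel Finset.univ (S.queOn Finset.univ θ s) ⊓ recRel F L Λ := by
    ext W W'
    change (S.ansRel _ _ W W' ∧ recRel F L _ W W') ↔ (S.ansRel _ _ W W' ∧ recRel F L _ W W')
    rw [ansRel_apply, recRel_apply, recRel_apply]
    refine and_congr_right fun h => ?_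
    have : W θ = W' θ :=
      S.isCorrect_iff.1 hS θ s hs W W' fun i => h ⟨i, Finset.mem_univ i⟩
    simp [this]
  simp only [cond, ansEntropy, this, partEntropy_recRel, Finset.card_insert_of_notMem hθ]
  push_cast
  ring

/-! ### Privacy: exchanging the desired record, and the converse bound -/

section Private

variable {T : ℕ} (hP : S.IsPrivate T)
include hP

theorem mean_cond_eq (Λ : Finset (Fin M)) (θ θ' : Fin M) {Γ : Finset (Fin N)}
    (hΓ : Γ.card = T) : mean S.seedLaw (fun s => S.cond Λ θ s Γ) =
      mean S.seedLaw (fun s => S.cond Λ θ' s Γ) := by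
  have h := S.isPrivate_iff.1 hP Γ hΓ θ θ'
  have h1 := mean_map S.seedLaw (S.queOn Γ θ) (S.ansEntropy Λ Γ)
  rw [h, mean_map] at h1
  exact h1.symm

/-- Equal laws have equal supports. Pointwise identities that come from equality cases pass in this
way from one desired record to another. -/
theorem forall_support_que {θ : Fin M} (θ' : Fin M) {Γ : Finset (Fin N)} (hΓ : Γ.card = T)
    {p : (∀ i : Γ, S.Query i.1) → Prop} (h : ∀ s ∈ S.seedLaw.support, p (S.queOn Γ θ s)) :
    ∀ s ∈ S.seedLaw.support, p (S.queOn Γ θ' s) := by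
  intro s hs
  have h1 : S.queOn Γ θ' s ∈ (S.seedLaw.map (S.queOn Γ θ')).support :=
    (PMF.mem_support_map_iff _ _ _).2 ⟨s, hs, rfl⟩
  rw [S.isPrivate_iff.1 hP Γ hΓ θ' θ] at h1
  obtain ⟨s', hs', he⟩ := (PMF.mem_support_map_iff _ _ _).1 h1
  rw [← he]
  exact h s' hs'

/-- The sum over T-sets is bounded above by monotonicity for θ and below by Han's inequality for θ',
and privacy identifies the means of the two sums. Equality of the outer means makes both bounds
sharp at every seed of the support. -/
theorem mean_cond_step (hT : 1 ≤ T) (hTN : T < N) (Λ : Finset (Fin M)) (θ θ' : Fin M) :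
    (T / N : ℝ) * mean S.seedLaw (fun s => S.cond Λ θ' s Finset.univ) ≤
      mean S.seedLaw (fun s => S.cond Λ θ s Finset.univ) ∧
    ((T / N : ℝ) * mean S.seedLaw (fun s => S.cond Λ θ' s Finset.univ) =
      mean S.seedLaw (fun s => S.cond Λ θ s Finset.univ) → ∀ s ∈ S.seedLaw.support,
      (∀ Γ : Finset (Fin N), Γ.card = T → S.cond Λ θ s Γ = S.cond Λ θ s Finset.univ) ∧
      ∑ Γ ∈ Finset.univ.powersetCard T, S.cond Λ θ' s Γ =
        (N - 1).choose (T - 1) * S.cond Λ θ' s Finset.univ) := by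
  have hN : (0 : ℝ) < N := by
    have : 0 < N := by omega
    exact_mod_cast this
  have hch : (0 : ℝ) < N.choose T := by exact_mod_cast Nat.choose_pos hTN.le
  have hid := choose_mul_eq hT hTN
  have hid' : (T / N : ℝ) * N.choose T = (N - 1).choose (T - 1) := by
    field_simp
    linarith
  have hcard : ((Finset.univ : Finset (Fin N)).powersetCard T).card = N.choose T := by
    simp
  have hmono : ∀ s ∈ S.seedLaw.support, ∑ Γ ∈ Finset.univ.powersetCard T, S.cond Λ θ s Γ ≤
      N.choose T * S.cond Λ θ s Finset.univ := by
    intro s _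
    rw [← hcard, ← nsmul_eq_mul]
    exact Finset.sum_le_card_nsmul _ _ _ fun Γ _ => S.cond_mono Λ θ s (Finset.subset_univ Γ)
  have hhan : ∀ s ∈ S.seedLaw.support, (N - 1).choose (T - 1) * S.cond Λ θ' s Finset.univ ≤
      ∑ Γ ∈ Finset.univ.powersetCard T, S.cond Λ θ' s Γ := by
    intro s _
    simpa using (S.cond_isSubmodular Λ θ' s).han hT
  have h1 := mean_mono hmono
  have h2 := mean_mono hhan
  have h3 : mean S.seedLaw (fun s => ∑ Γ ∈ Finset.univ.powersetCard T, S.cond Λ θ s Γ) =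
      mean S.seedLaw (fun s => ∑ Γ ∈ Finset.univ.powersetCard T, S.cond Λ θ' s Γ) := by
    rw [mean_sum, mean_sum]
    refine Finset.sum_congr rfl fun Γ hΓ => ?_
    exact S.mean_cond_eq hP Λ θ θ' (Finset.mem_powersetCard.1 hΓ).2
  rw [mean_const_mul] at h1 h2
  rw [← hid'] at h2
  refine ⟨?_, fun he => ?_⟩
  · refine le_of_mul_le_mul_left ?_ hch
    linarith
  · have e1 : mean S.seedLaw (fun s => ∑ Γ ∈ Finset.univ.powersetCard T, S.cond Λ θ s Γ) =
        mean S.seedLaw fun s => N.choose T * S.cond Λ θ s Finset.univ := by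
      rw [mean_const_mul]
      refine le_antisymm h1 ?_
      rw [← he, h3]
      linarith
    have e2 : mean S.seedLaw (fun s => (N - 1).choose (T - 1) * S.cond Λ θ' s Finset.univ) =
        mean S.seedLaw fun s => ∑ Γ ∈ Finset.univ.powersetCard T, S.cond Λ θ' s Γ := by
      rw [← h3, e1, mean_const_mul, mean_const_mul, ← he, ← hid']
      ring
    intro s hs
    refine ⟨fun Γ hΓ => ?_, (eq_of_mean_eq hhan e2 s hs).symm⟩
    have h4 := eq_of_mean_eq hmono e1 s hs
    rw [← hcard, ← nsmul_eq_mul, ← Finset.sum_const] at h4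
    exact (Finset.sum_eq_sum_iff_of_le fun Γ _ => S.cond_mono Λ θ s (Finset.subset_univ Γ)).1 h4 Γ
      (by simp [hΓ])

/-- Induction on the number m of unknown records other than θ: correctness contributes the term 1,
and the step to a further record θ' contributes T/N times the shorter geometric sum. -/
theorem mean_cond_ge (hC : S.IsCorrect) (hT : 1 ≤ T) (hTN : T < N) (m : ℕ) :
    ∀ (Λ : Finset (Fin M)) (θ : Fin M), θ ∉ Λ → Λ.card + (m + 1) = M →
      L * Real.log (Fintype.card F) * ∑ k ∈ Finset.range (m + 1), (T / N : ℝ) ^ k ≤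
        mean S.seedLaw (fun s => S.cond Λ θ s Finset.univ) := by
  induction m with
  | zero =>
    intro Λ θ hθ _
    rw [mean_congr fun s hs => S.cond_insert hC hθ hs, mean_add, mean_const]
    have := mean_mono (p := S.seedLaw) fun s _ => S.cond_nonneg (insert θ Λ) θ s Finset.univ
    rw [mean_const] at this
    simpa using this
  | succ m ih =>
    intro Λ θ hθ hc
    have hc' : (insert θ Λ).card + (m + 1) = M := by
      rw [Finset.card_insert_of_notMem hθ]
      omega
    obtain ⟨θ', hθ'⟩ : ∃ θ', θ' ∉ insert θ Λ := by
      by_contra! h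
      have := Finset.card_univ (α := Fin M)
      rw [← Finset.eq_univ_iff_forall.2 h, Fintype.card_fin] at this
      omega
    have h1 := (S.mean_cond_step hP hT hTN (insert θ Λ) θ θ').1
    have h2 := ih (insert θ Λ) θ' hθ' hc'
    rw [mean_congr fun s hs => S.cond_insert hC hθ hs, mean_add, mean_const,
      Finset.sum_range_succ', mul_add, pow_zero, mul_one]
    have h3 : (0 : ℝ) ≤ T / N := by positivity
    have h4 := mul_le_mul_of_nonneg_left h2 h3
    have h5 : L * Real.log (Fintype.card F) * ∑ k ∈ Finset.range (m + 1), (T / N : ℝ) ^ (k + 1) =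
        T / N * (L * Real.log (Fintype.card F) * ∑ k ∈ Finset.range (m + 1), (T / N : ℝ) ^ k) := by
      simp only [pow_succ', ← Finset.mul_sum]
      ring
    rw [h5]
    linarith

/-- In a scheme that attains the bound, the conditional entropies of the answers are the same for
all servers and all values of the random resources. -/
theorem cond_of_tight (hC : S.IsCorrect) (hT : 1 ≤ T) (hTN : T < N) {m : ℕ}
    {Λ : Finset (Fin M)} {θ θ' : Fin M} (hθ : θ ∉ Λ) (hθ' : θ' ∉ insert θ Λ)
    (hc : Λ.card + (m + 2) = M)
    (htight : mean S.seedLaw (fun s => S.cond Λ θ s Finset.univ) =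
      L * Real.log (Fintype.card F) * ∑ k ∈ Finset.range (m + 2), (T / N : ℝ) ^ k)
    (hconst : ∃ c, ∀ s ∈ S.seedLaw.support, S.cond Λ θ s Finset.univ = c) :
    mean S.seedLaw (fun s => S.cond (insert θ Λ) θ' s Finset.univ) =
      L * Real.log (Fintype.card F) * ∑ k ∈ Finset.range (m + 1), (T / N : ℝ) ^ k ∧
    ∃ e, ∀ s ∈ S.seedLaw.support, (∀ i, S.cond (insert θ Λ) θ' s {i} = e) ∧
      S.cond (insert θ Λ) θ' s Finset.univ = N * e := by
  have hN0 : 0 < N := by omega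
  have hN : (0 : ℝ) < N := by exact_mod_cast hN0
  have hT0 : (0 : ℝ) < T := by exact_mod_cast hT
  have h1 := S.mean_cond_step hP hT hTN (insert θ Λ) θ θ'
  have h2 := S.mean_cond_ge hP hC hT hTN m (insert θ Λ) θ' hθ' (by
    rw [Finset.card_insert_of_notMem hθ]
    omega)
  have h5 : L * Real.log (Fintype.card F) * ∑ k ∈ Finset.range (m + 1), (T / N : ℝ) ^ (k + 1) =
      T / N * (L * Real.log (Fintype.card F) * ∑ k ∈ Finset.range (m + 1), (T / N : ℝ) ^ k) := by
    simp only [pow_succ', ← Finset.mul_sum]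
    ring
  rw [mean_congr fun s hs => S.cond_insert hC hθ hs, mean_add, mean_const,
    Finset.sum_range_succ', mul_add, pow_zero, mul_one, h5] at htight
  have h3 : (0 : ℝ) < T / N := by positivity
  have h4 := mul_le_mul_of_nonneg_left h2 h3.le
  have heq : mean S.seedLaw (fun s => S.cond (insert θ Λ) θ' s Finset.univ) =
      L * Real.log (Fintype.card F) * ∑ k ∈ Finset.range (m + 1), (T / N : ℝ) ^ k := by
    refine mul_left_cancel₀ h3.ne' ?_
    linarith [h1.1]
  refine ⟨heq, ?_⟩
  have hpt := h1.2 (by rw [heq]; linarith)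
  obtain ⟨c, hc⟩ := hconst
  have hN' : T < Fintype.card (Fin N) := by simpa using hTN
  have hmod : ∀ s ∈ S.seedLaw.support, S.cond (insert θ Λ) θ' s Finset.univ =
      ∑ i, S.cond (insert θ Λ) θ' s {i} ∧ ∀ Γ : Finset (Fin N), Γ.card = T →
        S.cond (insert θ Λ) θ' s Γ = ∑ i ∈ Γ, S.cond (insert θ Λ) θ' s {i} := fun s hs =>
    (S.cond_isSubmodular (insert θ Λ) θ' s).han_eq hT hN' (by simpa using (hpt s hs).2)
  -- Additivity on T-sets, known for θ' from equality in Han's inequality, involves only queries to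
  -- T servers and so holds for θ.
  have hmod' : ∀ s ∈ S.seedLaw.support, ∀ Γ : Finset (Fin N), Γ.card = T →
      S.cond (insert θ Λ) θ s Γ = ∑ i ∈ Γ, S.cond (insert θ Λ) θ s {i} := by
    intro s hs Γ hΓ
    have := S.forall_support_que hP θ hΓ (θ := θ')
      (p := fun q => S.ansEntropy (insert θ Λ) Γ q =
        ∑ i : Γ, S.ansEntropyOne (insert θ Λ) i.1 (q i)) (by
        intro s hs
        have := (hmod s hs).2 Γ hΓ
        rw [← Finset.sum_coe_sort] at this
        simp only [cond_singleton] at this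
        exact this) s hs
    rw [← Finset.sum_coe_sort]
    simp only [cond_singleton]
    exact this
  -- For θ, every T-set carries the full entropy c - L log q, which no longer depends on the seed;
  -- by additivity each of its T servers must carry an equal share.
  set e : ℝ := (c - L * Real.log (Fintype.card F)) / T with he
  have hone : ∀ s ∈ S.seedLaw.support, ∀ i, S.cond (insert θ Λ) θ s {i} = e := by
    intro s hs i
    refine IsSubmodular.eq_of_sum_eq (S := Finset.univ)
      (δ := fun i => S.cond (insert θ Λ) θ s {i}) (ε := fun _ => e) hT
      (by simpa using hTN) (fun Γ _ hΓ => ?_) i (Finset.mem_univ i)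
    rw [← hmod' s hs Γ hΓ, (hpt s hs).1 Γ hΓ, Finset.sum_const, hΓ, nsmul_eq_mul, he]
    have := S.cond_insert hC hθ hs
    rw [hc s hs] at this
    field_simp
    linarith
  -- Back to θ' by privacy, with server i placed inside some T-set.
  have hone' : ∀ s ∈ S.seedLaw.support, ∀ i, S.cond (insert θ Λ) θ' s {i} = e := by
    intro s hs i
    obtain ⟨Γ, hi, -, hΓ⟩ := Finset.exists_subsuperset_card_eq
      (Finset.subset_univ ({i} : Finset (Fin N))) (by simpa using hT) (by simpa using hTN.le)
    have hiΓ : i ∈ Γ := hi (Finset.mem_singleton_self i)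
    have := S.forall_support_que hP θ' hΓ (θ := θ)
      (p := fun q => S.ansEntropyOne (insert θ Λ) i (q ⟨i, hiΓ⟩) = e) (by
        intro s hs
        rw [← hone s hs i, cond_singleton]
        rfl) s hs
    rw [cond_singleton]
    exact this
  refine ⟨e, fun s hs => ⟨hone' s hs, ?_⟩⟩
  rw [(hmod s hs).1, Finset.sum_congr rfl fun i _ => hone' s hs i]
  simp

end Private

/-! ### Rates -/

theorem entropy_record (θ : Fin M) : entropy S.law (fun ω => ω.2 θ) =
    L * Real.log (Fintype.card F) := by
  have h := partEntropy_ker_linearMap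
    (LinearMap.proj θ : Records F M L →ₗ[F] Fin L → F)
  rw [LinearMap.range_eq_top.2 (LinearMap.proj_surjective θ), finrank_top] at h
  rw [entropy_def, law_map]
  simp only [PMF.bind_const]
  rw [pmfEntropy_uniform_map]
  refine Eq.trans ?_ (h.trans ?_)
  · rfl
  · simp

theorem cond_empty_singleton (θ : Fin M) (s : S.Seed) (i : Fin N) : S.cond ∅ θ s {i} =
    pmfEntropy ((PMF.uniformOfFintype (Records F M L)).map fun W => S.answer θ s W i) := by
  have h : recRel F L (∅ : Finset (Fin M)) = ⊤ := by
    ext W W'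
    simp [recRel_apply]
  rw [cond_singleton, ansEntropyOne, h, inf_top_eq, partEntropy_top, sub_zero,
    pmfEntropy_uniform_map]
  rfl

theorem mean_cond_empty_le (θ : Fin M) (i : Fin N) :
    mean S.seedLaw (fun s => S.cond ∅ θ s {i}) ≤
      entropy S.law (fun ω => S.answer θ ω.1 ω.2 i) := by
  rw [entropy_def, law_map]
  simp only [cond_empty_singleton]
  exact mean_pmfEntropy_le _ _

/-- If the seed gives no information on the answer, the law of the answer is the same for every
seed. This supplies the constant c that starts the descent through `cond_of_tight`. -/
theorem cond_empty_const {θ : Fin M} {i : Fin N}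
    (h : mean S.seedLaw (fun s => S.cond ∅ θ s {i}) =
      entropy S.law (fun ω => S.answer θ ω.1 ω.2 i)) :
    ∀ s ∈ S.seedLaw.support, ∀ s' ∈ S.seedLaw.support, S.cond ∅ θ s {i} = S.cond ∅ θ s' {i} := by
  rw [entropy_def, law_map] at h
  simp only [cond_empty_singleton] at h ⊢
  intro s hs s' hs'
  rw [eq_of_pmfEntropy_bind h s hs s' hs']

theorem mean_cond_univ_le (θ : Fin M) : mean S.seedLaw (fun s => S.cond ∅ θ s Finset.univ) ≤
    mean S.seedLaw (fun s => ∑ i, S.cond ∅ θ s {i}) :=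
  mean_mono fun s _ => (S.cond_isSubmodular ∅ θ s).le_sum_singleton

theorem sum_entropy_answer_ge {T : ℕ} (hS : S.IsTPIR T) (hT : 1 ≤ T) (hTN : T < N) (θ : Fin M) :
    L * Real.log (Fintype.card F) * ∑ k ∈ Finset.range M, (T / N : ℝ) ^ k ≤
      ∑ i, entropy S.law (fun ω => S.answer θ ω.1 ω.2 i) := by
  have hM : 0 < M := θ.pos
  have h1 := S.mean_cond_ge hS.2 hS.1 hT hTN (M - 1) ∅ θ (by simp) (by simp; omega)
  rw [Nat.sub_add_cancel hM] at h1
  refine h1.trans ((S.mean_cond_univ_le θ).trans ?_)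
  rw [mean_sum]
  exact Finset.sum_le_sum fun i _ => S.mean_cond_empty_le θ i

theorem capacity_eq {N T : ℕ} (hTN : T < N) (M : ℕ) :
    (1 - (T : ℝ) / N) / (1 - ((T : ℝ) / N) ^ M) =
      1 / ∑ k ∈ Finset.range M, (T / N : ℝ) ^ k := by
  have hN : (0 : ℝ) < N := by
    have : 0 < N := by omega
    exact_mod_cast this
  have h1 : (T / N : ℝ) < 1 := (div_lt_one hN).2 (by exact_mod_cast hTN)
  rw [geom_sum_eq h1.ne, one_div_div, ← neg_div_neg_eq, neg_sub, neg_sub]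

theorem geom_pos {N T M : ℕ} (hM : 0 < M) : 0 < ∑ k ∈ Finset.range M, (T / N : ℝ) ^ k := by
  obtain ⟨m, rfl⟩ : ∃ m, M = m + 1 := ⟨M - 1, by omega⟩
  rw [Finset.sum_range_succ', pow_zero]
  positivity

theorem log_card_pos (F : Type) [Field F] [Fintype F] : 0 < Real.log (Fintype.card F) :=
  Real.log_pos (by exact_mod_cast Fintype.one_lt_card)

theorem rate_le {T : ℕ} (hS : S.IsTPIR T) (hT : 1 ≤ T) (hTN : T < N) (θ : Fin M) :
    S.rate θ ≤ 1 / ∑ k ∈ Finset.range M, (T / N : ℝ) ^ k := by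
  have h1 := S.sum_entropy_answer_ge hS hT hTN θ
  have h2 := geom_pos (N := N) (T := T) θ.pos
  have h3 := log_card_pos F
  rw [rate, entropy_record]
  -- Empty records are allowed in the model; their rate is 0 divided by the download, which is 0.
  rcases Nat.eq_zero_or_pos L with h0 | h0
  · subst h0
    simp only [Nat.cast_zero, zero_mul, zero_div]
    positivity
  · have h4 : (0 : ℝ) < L := by exact_mod_cast h0
    rw [div_le_div_iff₀ (lt_of_lt_of_le (by positivity) h1) h2]
    linarith

/-! ### The sub-packetization of linear schemes -/

/-- The conditional entropy is a difference of two ranks, times log q. -/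
theorem ansEntropyOne_of_isLinear (hL : S.IsLinear) (Λ : Finset (Fin M)) (i : Fin N)
    (x : S.Query i) : ∃ z : ℤ, S.ansEntropyOne Λ i x = z * Real.log (Fintype.card F) := by
  obtain ⟨len, e, h⟩ := hL
  obtain ⟨φ, hφ⟩ := h i x
  have h1 := partEntropy_ker_linearMap
    (φ.prod (LinearMap.funLeft F (Fin L → F) (Subtype.val : Λ → Fin M)))
  have h2 : Setoid.ker (S.ans i x) ⊓ recRel F L Λ = Setoid.ker
      (φ.prod (LinearMap.funLeft F (Fin L → F) (Subtype.val : Λ → Fin M))) := by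
    ext W W'
    change (S.ans i x W = S.ans i x W' ∧ recRel F L Λ W W') ↔ (_ : _ × _) = (_ : _ × _)
    rw [Prod.ext_iff, ← (e i).apply_eq_iff_eq, hφ, hφ]
    rfl
  refine ⟨(Module.finrank F (LinearMap.range
    (φ.prod (LinearMap.funLeft F (Fin L → F) (Subtype.val : Λ → Fin M)))) : ℤ) -
      (Λ.card * L : ℕ), ?_⟩
  rw [ansEntropyOne, h2, h1, partEntropy_recRel]
  push_cast
  ring

/-- In a tight scheme, with M - m ≥ 1 records known, the remaining conditional entropy L log q (1 +
… + (T/N)^(m-1)) is shared equally by the N servers, and each share is an integer multiple of log q.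
-/
theorem exists_int_of_linear {T : ℕ} (hS : S.IsTPIR T) (hL : S.IsLinear) (hT : 1 ≤ T)
    (hTN : T < N) (θ : Fin M) (hrate : S.rate θ = 1 / ∑ k ∈ Finset.range M, (T / N : ℝ) ^ k)
    (m : ℕ) (hm : 1 ≤ m) (hmM : m < M) :
    ∃ z : ℤ, L * ∑ k ∈ Finset.range m, (T / N : ℝ) ^ k = N * z := by
  have hM : 0 < M := θ.pos
  have hσ := geom_pos (N := N) (T := T) hM
  have hlog := log_card_pos F
  have hge := S.sum_entropy_answer_ge hS hT hTN θ
  have hsum : ∑ i, entropy S.law (fun ω => S.answer θ ω.1 ω.2 i) =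
      L * Real.log (Fintype.card F) * ∑ k ∈ Finset.range M, (T / N : ℝ) ^ k := by
    rw [rate, entropy_record] at hrate
    have hne : ∑ i, entropy S.law (fun ω => S.answer θ ω.1 ω.2 i) ≠ 0 := by
      intro h0
      rw [h0, div_zero] at hrate
      exact absurd hrate (by positivity)
    rw [div_eq_div_iff hne hσ.ne'] at hrate
    linarith
  have h1 := S.mean_cond_ge hS.2 hS.1 hT hTN (M - 1) ∅ θ (by simp) (by simp; omega)
  rw [Nat.sub_add_cancel hM] at h1
  have h2 := S.mean_cond_univ_le θ
  have h3 : mean S.seedLaw (fun s => ∑ i, S.cond ∅ θ s {i}) ≤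
      ∑ i, entropy S.law (fun ω => S.answer θ ω.1 ω.2 i) := by
    rw [mean_sum]
    exact Finset.sum_le_sum fun i _ => S.mean_cond_empty_le θ i
  have htight : mean S.seedLaw (fun s => S.cond ∅ θ s Finset.univ) =
      L * Real.log (Fintype.card F) * ∑ k ∈ Finset.range M, (T / N : ℝ) ^ k := by linarith
  have hpt := eq_of_mean_eq (fun s _ => (S.cond_isSubmodular ∅ θ s).le_sum_singleton)
    (show mean S.seedLaw (fun s => S.cond ∅ θ s Finset.univ) =
      mean S.seedLaw (fun s => ∑ i, S.cond ∅ θ s {i}) by linarith)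
  have hi : ∀ i, mean S.seedLaw (fun s => S.cond ∅ θ s {i}) =
      entropy S.law (fun ω => S.answer θ ω.1 ω.2 i) := by
    have h4 : mean S.seedLaw (fun s => ∑ i, S.cond ∅ θ s {i}) =
      ∑ i, entropy S.law (fun ω => S.answer θ ω.1 ω.2 i) := by linarith
    rw [mean_sum] at h4
    exact fun i => (Finset.sum_eq_sum_iff_of_le fun i _ => S.mean_cond_empty_le θ i).1 h4 i
      (Finset.mem_univ i)
  obtain ⟨s₀, hs₀⟩ := S.seedLaw.support_nonempty
  -- Descent along the number j of known records. Tightness and independence of the seed are carried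
  -- along because `cond_of_tight` needs both; integrality is produced only by a step, hence for j ≥
  -- 1.
  have key : ∀ j, j < M → ∃ (Λ : Finset (Fin M)) (θ : Fin M), Λ.card = j ∧ θ ∉ Λ ∧
      mean S.seedLaw (fun s => S.cond Λ θ s Finset.univ) =
        L * Real.log (Fintype.card F) * ∑ k ∈ Finset.range (M - j), (T / N : ℝ) ^ k ∧
      (∃ c, ∀ s ∈ S.seedLaw.support, S.cond Λ θ s Finset.univ = c) ∧
      (1 ≤ j → ∃ z : ℤ, L * ∑ k ∈ Finset.range (M - j), (T / N : ℝ) ^ k = N * z) := by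
    intro j
    induction j with
    | zero =>
      refine fun _ => ⟨∅, θ, rfl, by simp, htight, ⟨S.cond ∅ θ s₀ Finset.univ, fun s hs => ?_⟩,
        by simp⟩
      rw [hpt s hs, hpt s₀ hs₀]
      exact Finset.sum_congr rfl fun i _ => S.cond_empty_const (hi i) s hs s₀ hs₀
    | succ j ih =>
      intro hj
      obtain ⟨Λ, θ, hΛ, hθ, ht, hc, -⟩ := ih (by omega)
      obtain ⟨θ', hθ'⟩ : ∃ θ', θ' ∉ insert θ Λ := by
        by_contra! h
        have := Finset.card_univ (α := Fin M)
        rw [← Finset.eq_univ_iff_forall.2 h, Fintype.card_fin,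
          Finset.card_insert_of_notMem hθ] at this
        omega
      obtain ⟨m, hm⟩ : ∃ m, M - j = m + 2 := ⟨M - j - 2, by omega⟩
      rw [hm] at ht
      obtain ⟨ht', e, he⟩ := S.cond_of_tight hS.2 hS.1 hT hTN hθ hθ' (by omega) ht hc
      have hm' : M - (j + 1) = m + 1 := by omega
      refine ⟨insert θ Λ, θ', by rw [Finset.card_insert_of_notMem hθ, hΛ], hθ',
        by rw [hm', ht'], ⟨N * e, fun s hs => (he s hs).2⟩, fun _ => ?_⟩
      have hN : 0 < N := by omega
      obtain ⟨z, hz⟩ := S.ansEntropyOne_of_isLinear hL (insert θ Λ) ⟨0, hN⟩ (S.que θ' s₀ ⟨0, hN⟩)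
      rw [← cond_singleton, (he s₀ hs₀).1] at hz
      rw [mean_congr fun s hs => (he s hs).2, mean_const, hz] at ht'
      refine ⟨z, mul_right_cancel₀ hlog.ne' ?_⟩
      rw [hm']
      linarith
  obtain ⟨_, _, -, -, -, -, h⟩ := key (M - m) (by omega)
  obtain ⟨z, hz⟩ := h (by omega)
  rw [Nat.sub_sub_self hmM.le] at hz
  exact ⟨z, hz⟩

end Scheme

/-! ### Divisibility of the sub-packetization -/

theorem redN_mul_gcd (N T : ℕ) : redN N T * N.gcd T = N := Nat.div_mul_cancel (Nat.gcd_dvd_left N T)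

theorem redT_mul_gcd (N T : ℕ) : redT N T * N.gcd T = T :=
  Nat.div_mul_cancel (Nat.gcd_dvd_right N T)

theorem coprime_red {N T : ℕ} (hN : 0 < N) : (redN N T).Coprime (redT N T) :=
  Nat.coprime_div_gcd_div_gcd (Nat.gcd_pos_of_pos_left _ hN)

theorem div_eq_red {N T : ℕ} (hN : 0 < N) : (T / N : ℝ) = redT N T / redN N T := by
  have hg : (0 : ℝ) < N.gcd T := by exact_mod_cast Nat.gcd_pos_of_pos_left _ hN
  have h1 : (redN N T * N.gcd T : ℝ) = N := by exact_mod_cast redN_mul_gcd N T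
  have h2 : (redT N T * N.gcd T : ℝ) = T := by exact_mod_cast redT_mul_gcd N T
  rw [← h1, ← h2, mul_div_mul_right _ _ hg.ne']

/-- The case m = 1 gives L = N z₁. Subtracting the cases m = M - 1 and m = M - 2 isolates z₁
(t/n)^(M-2) as an integer, so n^(M-2) divides z₁ by coprimality. -/
theorem subpack_le_of_int {N T M L : ℕ} (hL : 0 < L) (hN : 0 < N) (hM : 2 ≤ M)
    (h : ∀ m, 1 ≤ m → m < M → ∃ z : ℤ, L * ∑ k ∈ Finset.range m, (T / N : ℝ) ^ k = N * z) :
    subpack N T M ≤ L := by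
  have hN' : (N : ℝ) ≠ 0 := by positivity
  have hn : 0 < redN N T := by
    by_contra h0
    have := redN_mul_gcd N T
    rw [Nat.eq_zero_of_not_pos h0, zero_mul] at this
    omega
  have hn' : (redN N T : ℝ) ≠ 0 := by positivity
  obtain ⟨z₁, h1⟩ := h 1 le_rfl (by omega)
  have hL1 : (L : ℤ) = N * z₁ := by
    simp only [Finset.range_one, Finset.sum_singleton, pow_zero, mul_one] at h1
    exact_mod_cast h1
  have hdvd : ((redN N T : ℤ) ^ (M - 2)) ∣ z₁ := by
    have hcop : IsCoprime ((redN N T : ℤ) ^ (M - 2)) ((redT N T : ℤ) ^ (M - 2)) :=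
      (Nat.isCoprime_iff_coprime.2 (coprime_red hN)).pow
    rcases Nat.eq_zero_or_pos (M - 2) with h0 | h0
    · simp [h0]
    obtain ⟨a, ha⟩ := h (M - 1) (by omega) (by omega)
    obtain ⟨b, hb⟩ := h (M - 2) h0 (by omega)
    have hM1 : M - 1 = M - 2 + 1 := by omega
    rw [hM1, Finset.sum_range_succ, mul_add, hb, div_eq_red hN, div_pow] at ha
    have hL1' : (L : ℝ) = N * z₁ := by exact_mod_cast hL1
    have e : (z₁ : ℝ) * redT N T ^ (M - 2) = redN N T ^ (M - 2) * (a - b) := by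
      rw [hL1'] at ha
      field_simp at ha
      linarith
    have e' : z₁ * (redT N T : ℤ) ^ (M - 2) = (redN N T : ℤ) ^ (M - 2) * (a - b) := by
      exact_mod_cast e
    exact hcop.dvd_of_dvd_mul_right ⟨a - b, e'⟩
  have : ((subpack N T M : ℕ) : ℤ) ∣ L := by
    rw [hL1, subpack]
    push_cast
    exact mul_dvd_mul_left _ hdvd
  exact Nat.le_of_dvd hL (by exact_mod_cast this)

open Matrix

/-! ### Counting the sums -/

section Counting

variable {N T : ℕ}

theorem redT_pos (hT : 1 ≤ T) : 0 < redT N T := by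
  by_contra h
  have := redT_mul_gcd N T
  rw [Nat.eq_zero_of_not_pos h, zero_mul] at this
  omega

theorem redT_lt_redN (hTN : T < N) : redT N T < redN N T := by
  by_contra! h
  have h1 := Nat.mul_le_mul_right (N.gcd T) h
  rw [redN_mul_gcd, redT_mul_gcd] at h1
  omega

theorem sub_mul_gcd : (redN N T - redT N T) * N.gcd T = N - T := by
  rw [Nat.sub_mul, redN_mul_gcd, redT_mul_gcd]

theorem subpack_eq {M : ℕ} (hM : 2 ≤ M) : subpack N T M = N.gcd T * redN N T ^ (M - 1) := by
  obtain ⟨m, rfl⟩ : ∃ m, M = m + 2 := ⟨M - 2, by omega⟩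
  have h : m + 2 - 1 = m + 1 := by omega
  rw [subpack, h, pow_succ', ← mul_assoc, mul_comm (N.gcd T), redN_mul_gcd, Nat.add_sub_cancel]

theorem T_mul_blockLen {M k : ℕ} (hk : k < M) : T * blockLen N T M k =
    N.gcd T * ((redN N T - redT N T) ^ (k - 1) * redT N T ^ (M - k)) := by
  obtain ⟨m, hm⟩ : ∃ m, M - k = m + 1 := ⟨M - k - 1, by omega⟩
  have h : M - 1 - k = m := by omega
  rw [blockLen, hm, h, pow_succ]
  calc _ = redT N T * N.gcd T * ((redN N T - redT N T) ^ (k - 1) * redT N T ^ m) := by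
        rw [redT_mul_gcd]
    _ = _ := by ring

theorem sub_mul_blockLen {M : ℕ} (hM : 2 ≤ M) : (N - T) * blockLen N T M (M - 1) =
    N.gcd T * ((redN N T - redT N T) ^ (M - 1) * redT N T ^ (M - M)) := by
  obtain ⟨m, rfl⟩ : ∃ m, M = m + 2 := ⟨M - 2, by omega⟩
  have h : m + 2 - 1 = m + 1 := by omega
  rw [blockLen, h, ← sub_mul_gcd]
  simp only [Nat.add_sub_cancel, Nat.sub_self, pow_zero, pow_succ]
  ring

/-- The numbers of sums of all servers of a type with `k` records, if they satisfy the conditions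
of a design. -/
theorem sum_sumCount {α β : ℕ → ℕ} {M : ℕ} (hM : 2 ≤ M)
    (hsplit : ∀ k, 1 ≤ k → k < M → ∀ i : Fin N,
      sumCount T α β k i + sumCount T α β (k + 1) i = blockLen N T M k)
    (hsum : ∀ k, 1 ≤ k → k < M → ∑ i : Fin N, sumCount T α β k i = T * blockLen N T M k)
    {k : ℕ} (hk : 1 ≤ k) (hkM : k ≤ M) : ∑ i : Fin N, sumCount T α β k i =
      N.gcd T * ((redN N T - redT N T) ^ (k - 1) * redT N T ^ (M - k)) := by
  rcases hkM.lt_or_eq with h | rfl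
  · rw [hsum k hk h, T_mul_blockLen h]
  -- There is no code with index M: the total for k = M is what the (M-1)-st split leaves, N ℓ_(M-1)
  -- - T ℓ_(M-1).
  · have h1 := Finset.sum_congr rfl fun i (_ : i ∈ Finset.univ) =>
      hsplit (k - 1) (by omega) (by omega) i
    rw [Finset.sum_add_distrib, hsum (k - 1) (by omega) (by omega), Nat.sub_add_cancel hk] at h1
    simp only [Finset.sum_const, Finset.card_univ, Fintype.card_fin, smul_eq_mul] at h1
    rw [← sub_mul_blockLen hM, Nat.sub_mul]
    omega

end Counting

/-! ### Linear algebra -/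

section LinearAlgebra

variable {F : Type} [Field F]

theorem vecMul_eq_zero_of_rank {ι : Type} [Fintype ι] {r : ℕ} {A : Matrix (Fin r) ι F}
    (hA : A.rank = r) {v : Fin r → F} (hv : v ᵥ* A = 0) : v = 0 := by
  have hli : LinearIndependent F A.row := by
    rw [linearIndependent_iff_card_eq_finrank_span, Fintype.card_fin, Set.finrank,
      ← Matrix.rank_eq_finrank_span_row, hA]
  exact Matrix.vecMul_injective_iff.2 hli (by simpa using hv)

theorem linearIndependent_col_of_rank {ι κ : Type} [Fintype ι] {A : Matrix κ ι F}
    (hA : A.rank = Fintype.card ι) : LinearIndependent F A.col := by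
  rw [linearIndependent_iff_card_eq_finrank_span, Set.finrank,
    ← Matrix.rank_eq_finrank_span_cols, hA]

/-- An isomorphism between two subspaces of a finite-dimensional space extends to an automorphism.
-/
theorem exists_GL_mulVec_eq {X n : Type} [Fintype n] [DecidableEq n] {u v : X → n → F}
    (hu : LinearIndependent F u) (hv : LinearIndependent F v) :
    ∃ B : GL n F, ∀ x, B.1 *ᵥ u x = v x := by
  obtain ⟨g, hg⟩ := Submodule.exists_linearEquiv_restrict_eq
    ((Module.Basis.span hu).equiv (Module.Basis.span hv) (Equiv.refl X))
  refine ⟨GeneralLinearGroup.toLin.symm (LinearMap.GeneralLinearGroup.ofLinearEquiv g),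
    fun x => ?_⟩
  have h2 : (GeneralLinearGroup.toLin.symm (LinearMap.GeneralLinearGroup.ofLinearEquiv g)).1 =
      LinearMap.toMatrix' (g : (n → F) →ₗ[F] n → F) := rfl
  have h3 := hg (Module.Basis.span hu x)
  rw [Module.Basis.equiv_apply, Equiv.refl_apply, Module.Basis.span_apply,
    Module.Basis.span_apply] at h3
  rw [h2, LinearMap.toMatrix'_mulVec]
  exact h3.symm

end LinearAlgebra

/-! ### The scheme of a design -/

namespace Design

variable {F : Type} [Field F] {N T M : ℕ} (D : Design F N T M)

theorem sums_ext {α β : ℕ → ℕ} {y y' : (i : Fin N) × Sums T M α β i} (h1 : y.1 = y'.1)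
    (h2 : y.2.1.1 = y'.2.1.1) (h3 : (y.2.2 : ℕ) = y'.2.2) : y = y' := by
  obtain ⟨i, ⟨Λ, hΛ⟩, r⟩ := y
  obtain ⟨i', ⟨Λ', hΛ'⟩, r'⟩ := y'
  simp only at h1 h2 h3
  subst h1 h2
  rw [Fin.ext h3]

/-- The coefficients, in terms of the columns of the random matrix, of a symbol of a codeword. -/
def codeVec (θ j : Fin M) (Λ : Finset (Fin M)) (i : Fin N) (c : ℕ) : Fin (subpack N T M) → F :=
  if h : c < blockLen N T M Λ.card then
    ∑ m, D.G Λ.card m (i, ⟨c, h⟩) • Pi.single (D.sideCol θ j ⟨Λ, m⟩) 1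
  else 0

theorem codeSymbol_eq (θ j : Fin M) (Λ : Finset (Fin M))
    (A : Matrix (Fin (subpack N T M)) (Fin (subpack N T M)) F) (i : Fin N) (c : ℕ) :
    D.codeSymbol θ j Λ A i c = A *ᵥ D.codeVec θ j Λ i c := by
  unfold codeSymbol codeVec
  split_ifs
  · ext a
    simp [Matrix.mulVec_sum, Matrix.mulVec_smul, mul_comm]
  · simp

/-- The position in its codeword of the symbols in a sum. -/
def sumPos (θ : Fin M) (y : (i : Fin N) × Sums T M D.α D.β i) : ℕ :=
  if θ ∈ y.2.1.1 then sumCount T D.α D.β (y.2.1.1.erase θ).card y.1 + y.2.2 else y.2.2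

/-- The coefficients of record `j` in a sum, in terms of the columns of the random matrix. -/
def queryVec (θ j : Fin M) (y : (i : Fin N) × Sums T M D.α D.β i) : Fin (subpack N T M) → F :=
  if j ∉ y.2.1.1 then 0
  else if j = θ then Pi.single (D.desiredCol θ y) 1
  else D.codeVec θ j (y.2.1.1.erase θ) y.1 (D.sumPos θ y)

theorem coeff_eq (θ : Fin M) (S : Fin M → GL (Fin (subpack N T M)) F) (i : Fin N)
    (x : Sums T M D.α D.β i) (j : Fin M) :
    D.coeff θ S i x j = (S j).1 *ᵥ D.queryVec θ j ⟨i, x⟩ := by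
  unfold coeff queryVec sumPos
  by_cases hj : j ∈ x.1.1
  · by_cases hjθ : j = θ
    · subst hjθ
      ext a
      simp [hj]
    · by_cases hθ : θ ∈ x.1.1
      · simp [hj, hjθ, hθ, codeSymbol_eq]
      · simp [hj, hjθ, hθ, codeSymbol_eq]
  · simp [hj]

theorem sumPos_lt {θ j : Fin M} (hj : j ≠ θ) {y : (i : Fin N) × Sums T M D.α D.β i}
    (hy : j ∈ y.2.1.1) : D.sumPos θ y < blockLen N T M (y.2.1.1.erase θ).card := by
  have h1 : 1 ≤ (y.2.1.1.erase θ).card :=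
    Finset.card_pos.2 ⟨j, Finset.mem_erase.2 ⟨hj, hy⟩⟩
  have h2 : (y.2.1.1.erase θ).card < M := by
    have := Finset.card_lt_univ_of_notMem (Finset.notMem_erase θ y.2.1.1)
    simpa using this
  have h3 := D.split _ h1 h2 y.1
  have h4 := y.2.2.2
  unfold sumPos
  by_cases hθ : θ ∈ y.2.1.1
  · rw [if_pos hθ]
    have h5 : (y.2.1.1.erase θ).card + 1 = y.2.1.1.card := Finset.card_erase_add_one hθ
    rw [h5] at h3
    omega
  · rw [if_neg hθ]
    rw [Finset.erase_eq_of_notMem hθ] at h3 ⊢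
    omega

/-! ### Privacy of the scheme -/

section Privacy

/-- Symbols of the codewords at `T` servers. -/
abbrev SidePos (N T M : ℕ) (θ j : Fin M) (Γ : Finset (Fin N)) : Type :=
  (Λ : {Λ : Finset (Fin M) // j ∈ Λ ∧ θ ∉ Λ}) × (Γ × Fin (blockLen N T M Λ.1.card))

/-- Vectors of different Λ have disjoint supports, because the assigned columns are disjoint. Within
one Λ they are the columns of T thick columns of the generator, independent by the MDS property. -/
theorem linearIndependent_codeVec {θ j : Fin M} (hj : j ≠ θ) {Γ : Finset (Fin N)}
    (hΓ : Γ.card = T) : LinearIndependent F fun z : SidePos N T M θ j Γ =>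
      D.codeVec θ j z.1.1 z.2.1 z.2.2 := by
  classical
  rw [Fintype.linearIndependent_iff]
  intro g hg
  rintro ⟨⟨Λ, hΛ⟩, p⟩
  have hk1 : 1 ≤ Λ.card := Finset.card_pos.2 ⟨j, hΛ.1⟩
  have hk2 : Λ.card < M := by simpa using Finset.card_lt_univ_of_notMem hΛ.2
  have hli := linearIndependent_col_of_rank
    (A := (D.G Λ.card).submatrix id
      (fun c : Γ × Fin (blockLen N T M Λ.card) => ((c.1 : Fin N), c.2)))
    (by rw [(D.mds _ hk1 hk2).2 Γ hΓ]; simp [hΓ])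
  rw [Fintype.linearIndependent_iff] at hli
  refine hli (fun p => g ⟨⟨Λ, hΛ⟩, p⟩) ?_ p
  ext m
  have h1 := congrFun hg (D.sideCol θ j ⟨Λ, m⟩)
  rw [Finset.sum_apply, Fintype.sum_sigma, Finset.sum_eq_single
    (⟨Λ, hΛ⟩ : {Λ : Finset (Fin M) // j ∈ Λ ∧ θ ∉ Λ})] at h1
  · rw [Finset.sum_apply]
    refine Eq.trans (Finset.sum_congr rfl fun p _ => ?_) h1
    simp only [Pi.smul_apply, smul_eq_mul, Matrix.col_apply, Matrix.submatrix_apply, id]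
    congr 1
    rw [codeVec, dif_pos p.2.2, Finset.sum_apply, Finset.sum_eq_single m]
    · simp
    · intro m' _ hm
      have : D.sideCol θ j ⟨Λ, m⟩ ≠ D.sideCol θ j ⟨Λ, m'⟩ := by
        intro h
        have := D.sideCol_inj θ j hj (by exact hΛ) (by exact hΛ) h
        simp only [Sigma.mk.injEq, heq_eq_eq, true_and] at this
        exact hm this.symm
      simp [this]
    · simp
  · rintro ⟨Λ', hΛ'⟩ _ hne
    refine Finset.sum_eq_zero fun p _ => ?_
    rw [Pi.smul_apply, codeVec, dif_pos p.2.2, Finset.sum_apply, Finset.sum_eq_zero, smul_zero]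
    intro m' _
    have : D.sideCol θ j ⟨Λ, m⟩ ≠ D.sideCol θ j ⟨Λ', m'⟩ := by
      intro h
      have := D.sideCol_inj θ j hj (by exact hΛ) (by exact hΛ') h
      simp only [Sigma.mk.injEq] at this
      exact hne (Subtype.ext this.1.symm)
    simp [this]
  · simp

/-- The sums of the servers in `Γ` that involve record `j`. -/
abbrev SumsOn (Γ : Finset (Fin N)) (j : Fin M) : Type :=
  {y : (i : Fin N) × Sums T M D.α D.β i // y.1 ∈ Γ ∧ j ∈ y.2.1.1}

/-- The index set, all sums at Γ involving j, does not mention θ; this is what makes the families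
for two desired records comparable. For j = θ the vectors are distinct unit vectors, otherwise
distinct codeword symbols. -/
theorem linearIndependent_queryVec (θ j : Fin M) {Γ : Finset (Fin N)} (hΓ : Γ.card = T) :
    LinearIndependent F fun y : D.SumsOn Γ j => D.queryVec θ j y.1 := by
  by_cases hj : j = θ
  · subst hj
    have h := (Pi.basisFun F (Fin (subpack N T M))).linearIndependent.comp
      (fun y : D.SumsOn Γ j => D.desiredCol j y.1) (by
        intro y y' h
        exact Subtype.ext ((D.desiredCol_bij j).injOn y.2.2 y'.2.2 h))
    convert h using 1
    ext y a
    simp [queryVec, y.2.2]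
  · have h := (D.linearIndependent_codeVec hj hΓ).comp
      (fun y : D.SumsOn Γ j => (⟨⟨y.1.2.1.1.erase θ, Finset.mem_erase.2 ⟨hj, y.2.2⟩,
        Finset.notMem_erase _ _⟩, ⟨y.1.1, y.2.1⟩, ⟨D.sumPos θ y.1, D.sumPos_lt hj y.2.2⟩⟩ :
          SidePos N T M θ j Γ)) (by
        intro y y' h
        have h1 : y.1.2.1.1.erase θ = y'.1.2.1.1.erase θ :=
          congrArg (fun z : SidePos N T M θ j Γ => z.1.1) h
        have h2 : y.1.1 = y'.1.1 := congrArg (fun z : SidePos N T M θ j Γ => (z.2.1 : Fin N)) h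
        have h3 : D.sumPos θ y.1 = D.sumPos θ y'.1 :=
          congrArg (fun z : SidePos N T M θ j Γ => (z.2.2 : ℕ)) h
        have h4 := y.1.2.2.2
        have h4' := y'.1.2.2.2
        unfold sumPos at h3
        -- A sum of type Λ and one of type Λ ∪ {θ} draw on the same codeword, but at positions below
        -- γ and from γ on respectively, so the mixed cases are impossible.
        by_cases hy : θ ∈ y.1.2.1.1 <;> by_cases hy' : θ ∈ y'.1.2.1.1
        · have e : sumCount T D.α D.β (y.1.2.1.1.erase θ).card y.1.1 =
              sumCount T D.α D.β (y'.1.2.1.1.erase θ).card y'.1.1 := by rw [h1, h2]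
          rw [if_pos hy, if_pos hy', e] at h3
          refine Subtype.ext (sums_ext h2 ?_ (by omega))
          rw [← Finset.insert_erase hy, h1, Finset.insert_erase hy']
        · have e : sumCount T D.α D.β (y.1.2.1.1.erase θ).card y.1.1 =
              sumCount T D.α D.β y'.1.2.1.1.card y'.1.1 := by
            rw [h1, h2, Finset.erase_eq_of_notMem hy']
          rw [if_pos hy, if_neg hy', e] at h3
          omega
        · have e : sumCount T D.α D.β (y'.1.2.1.1.erase θ).card y'.1.1 =
              sumCount T D.α D.β y.1.2.1.1.card y.1.1 := by
            rw [← h1, ← h2, Finset.erase_eq_of_notMem hy]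
          rw [if_neg hy, if_pos hy', e] at h3
          omega
        · rw [if_neg hy, if_neg hy'] at h3
          rw [Finset.erase_eq_of_notMem hy, Finset.erase_eq_of_notMem hy'] at h1
          exact Subtype.ext (sums_ext h2 h1 h3))
    convert h using 1
    ext y a
    simp [queryVec, y.2.2, hj]

theorem _root_.TPIR.map_uniform_of_bijective {A : Type} [Fintype A] [Nonempty A] {f : A → A}
    (hf : f.Bijective) : (PMF.uniformOfFintype A).map f = PMF.uniformOfFintype A := by
  ext b
  obtain ⟨a, rfl⟩ := hf.2 b
  rw [map_apply_of_injective hf.1, PMF.uniformOfFintype_apply, PMF.uniformOfFintype_apply]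

variable [Fintype F]

/-- The independent families for θ and θ' differ by an invertible matrix B_j, and S_j ↦ S_j B_j
preserves the uniform law; hence the T servers see equally distributed queries. -/
theorem scheme_isPrivate : D.scheme.IsPrivate T := by
  rw [Scheme.isPrivate_iff]
  intro Γ hΓ θ θ'
  choose B hB using fun j => exists_GL_mulVec_eq (D.linearIndependent_queryVec θ j hΓ)
    (D.linearIndependent_queryVec θ' j hΓ)
  let σ : (Fin M → GL (Fin (subpack N T M)) F) → Fin M → GL (Fin (subpack N T M)) F :=
    fun S j => S j * B j
  have hσ : D.scheme.seedLaw.map σ = D.scheme.seedLaw :=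
    @map_uniform_of_bijective _ (Fintype.ofFinite _) _ σ (Group.mulRight_bijective B)
  have hq : D.scheme.queOn Γ θ' = D.scheme.queOn Γ θ ∘ σ := by
    funext S i x j
    change D.coeff θ' S i.1 x j = D.coeff θ (σ S) i.1 x j
    refine (D.coeff_eq θ' S i.1 x j).trans (Eq.trans ?_ (D.coeff_eq θ (σ S) i.1 x j).symm)
    by_cases hj : j ∈ x.1.1
    · rw [← hB j ⟨⟨i.1, x⟩, i.2, hj⟩, Matrix.mulVec_mulVec]
      rfl
    · simp [queryVec, hj]
  rw [hq]
  exact (congrArg (PMF.map (D.scheme.queOn Γ θ)) hσ).symm.trans (PMF.map_comp _ _ _)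

end Privacy

/-! ### Decoding and linearity of the scheme -/

section Correctness

theorem dotProduct_codeVec (θ j : Fin M) (Λ : Finset (Fin M)) (i : Fin N) {c : ℕ}
    (hc : c < blockLen N T M Λ.card) (Y : Fin (subpack N T M) → F) :
    Y ⬝ᵥ D.codeVec θ j Λ i c = ∑ m, Y (D.sideCol θ j ⟨Λ, m⟩) * D.G Λ.card m (i, ⟨c, hc⟩) := by
  rw [codeVec, dif_pos hc, dotProduct_sum]
  refine Finset.sum_congr rfl fun m _ => ?_
  rw [dotProduct_smul, dotProduct_single, mul_one, smul_eq_mul, mul_comm]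

theorem ans_eq (θ : Fin M) (S : Fin M → GL (Fin (subpack N T M)) F)
    (W : Records F M (subpack N T M)) (i : Fin N) (x : Sums T M D.α D.β i) :
    ∑ j, ∑ a, D.coeff θ S i x j a * W j a =
      (if θ ∈ x.1.1 then (W θ ᵥ* (S θ).1) (D.desiredCol θ ⟨i, x⟩) else 0) +
      ∑ j ∈ x.1.1.erase θ,
        (W j ᵥ* (S j).1) ⬝ᵥ D.codeVec θ j (x.1.1.erase θ) i (D.sumPos θ ⟨i, x⟩) := by
  have h1 : ∀ j, ∑ a, D.coeff θ S i x j a * W j a =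
      (W j ᵥ* (S j).1) ⬝ᵥ D.queryVec θ j ⟨i, x⟩ := by
    intro j
    rw [← Matrix.dotProduct_mulVec, ← coeff_eq, dotProduct_comm]
    rfl
  have h2 : ∑ j, ∑ a, D.coeff θ S i x j a * W j a =
      ∑ j ∈ x.1.1, (W j ᵥ* (S j).1) ⬝ᵥ D.queryVec θ j ⟨i, x⟩ := by
    simp only [h1]
    symm
    refine Finset.sum_subset (Finset.subset_univ _) fun j _ hj => ?_
    simp [queryVec, hj]
  have h3 : ∀ j ∈ x.1.1.erase θ, (W j ᵥ* (S j).1) ⬝ᵥ D.queryVec θ j ⟨i, x⟩ =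
      (W j ᵥ* (S j).1) ⬝ᵥ D.codeVec θ j (x.1.1.erase θ) i (D.sumPos θ ⟨i, x⟩) := by
    intro j hj
    have := Finset.mem_erase.1 hj
    simp [queryVec, this.1, this.2]
  rw [h2, ← Finset.sum_congr rfl h3]
  split_ifs with hθ
  · rw [← Finset.add_sum_erase _ _ hθ]
    simp [queryVec, hθ]
  · rw [Finset.erase_eq_of_notMem hθ, zero_add]

variable [Fintype F]

/-- By linearity it suffices to show that vanishing answers to the difference V of two databases
force V_θ = 0: the interference vanishes, then every entry of V_θ S_θ does, and S_θ is invertible.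
-/
theorem scheme_isCorrect : D.scheme.IsCorrect := by
  rw [Scheme.isCorrect_iff]
  intro θ S _ W W' hWW
  change Fin M → GL (Fin (subpack N T M)) F at S
  set V : Records F M (subpack N T M) := W - W' with hV
  have h0 : ∀ i x, ∑ j, ∑ a, D.coeff θ S i x j a * V j a = 0 := by
    intro i x
    have : ∑ j, ∑ a, D.coeff θ S i x j a * W j a = ∑ j, ∑ a, D.coeff θ S i x j a * W' j a :=
      congrFun (hWW i) x
    simp only [hV, Pi.sub_apply, mul_sub, Finset.sum_sub_distrib, this, sub_self]
  simp only [ans_eq] at h0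
  -- the sums of codewords for sets of undesired records vanish
  have hside : ∀ Λ : Finset (Fin M), θ ∉ Λ → ∀ (i : Fin N) (c : ℕ),
      c < blockLen N T M Λ.card → ∑ j ∈ Λ, (V j ᵥ* (S j).1) ⬝ᵥ D.codeVec θ j Λ i c = 0 := by
    intro Λ hθ
    rcases Λ.eq_empty_or_nonempty with rfl | hne
    · simp
    have hk1 : 1 ≤ Λ.card := Finset.card_pos.2 hne
    have hk2 : Λ.card < M := by simpa using Finset.card_lt_univ_of_notMem hθ
    -- All j ∈ Λ use the same code, so the sum of their codewords is the codeword of the summed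
    -- message μ. The sums of type Λ show its first γ positions at each server, which determine μ by
    -- recovery.
    let μ : Fin (T * blockLen N T M Λ.card) → F :=
      fun m => ∑ j ∈ Λ, (V j ᵥ* (S j).1) (D.sideCol θ j ⟨Λ, m⟩)
    have hμ : ∀ (i : Fin N) (c : ℕ) (hc : c < blockLen N T M Λ.card),
        ∑ j ∈ Λ, (V j ᵥ* (S j).1) ⬝ᵥ D.codeVec θ j Λ i c = (μ ᵥ* D.G Λ.card) (i, ⟨c, hc⟩) := by
      intro i c hc
      refine (Finset.sum_congr rfl fun j _ => D.dotProduct_codeVec θ j Λ i hc _).trans ?_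
      rw [Finset.sum_comm]
      exact Finset.sum_congr rfl fun m _ => (Finset.sum_mul _ _ _).symm
    have hrec := D.recovery _ hk1 hk2
    have hz : μ = 0 := by
      refine vecMul_eq_zero_of_rank hrec.2.2 ?_
      ext ⟨⟨i, c⟩, hc⟩
      have h1 := h0 i ⟨⟨Λ, hne⟩, ⟨c, hc⟩⟩
      simp only [hθ, if_false, zero_add, Finset.erase_eq_of_notMem hθ, sumPos] at h1
      rw [hμ i c c.2] at h1
      exact h1
    intro i c hc
    rw [hμ i c hc, hz, Matrix.zero_vecMul]
    rfl
  have hcol : V θ ᵥ* (S θ).1 = 0 := by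
    ext b
    obtain ⟨⟨i, x⟩, hx, rfl⟩ := (D.desiredCol_bij θ).surjOn (Set.mem_univ b)
    have hx' : θ ∈ x.1.1 := hx
    have h1 := h0 i x
    rw [if_pos hx'] at h1
    rcases (x.1.1.erase θ).eq_empty_or_nonempty with he | ⟨j, hj⟩
    · rw [he, Finset.sum_empty, add_zero] at h1
      exact h1
    · rw [hside _ (Finset.notMem_erase _ _) i _ (D.sumPos_lt (Finset.ne_of_mem_erase hj)
        (y := ⟨i, x⟩) (Finset.mem_of_mem_erase hj)), add_zero] at h1
      exact h1
  have hzero : V θ = 0 := by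
    have h2 := congrArg (fun v => v ᵥ* (S θ)⁻¹.1) hcol
    simp only [Matrix.vecMul_vecMul, Matrix.zero_vecMul] at h2
    have h3 : (S θ).1 * (S θ)⁻¹.1 = 1 := (S θ).mul_inv
    rwa [h3, Matrix.vecMul_one] at h2
  exact sub_eq_zero.1 hzero

theorem scheme_isTPIR : D.scheme.IsTPIR T := ⟨D.scheme_isCorrect, D.scheme_isPrivate⟩

theorem scheme_isLinear : D.scheme.IsLinear := by
  refine ⟨fun i => Fintype.card (Sums T M D.α D.β i),
    fun i => (Equiv.arrowCongr (Fintype.equivFin _) (Equiv.refl F)), fun i Q => ?_⟩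
  let e := Fintype.equivFin (Sums T M D.α D.β i)
  change Sums T M D.α D.β i → Fin M → Fin (subpack N T M) → F at Q
  refine ⟨LinearMap.pi fun r => ∑ j, ∑ a, Q (e.symm r) j a •
    (LinearMap.proj a ∘ₗ LinearMap.proj j : Records F M (subpack N T M) →ₗ[F] F), fun W => ?_⟩
  ext r
  simp only [LinearMap.pi_apply, LinearMap.sum_apply, LinearMap.smul_apply, smul_eq_mul]
  rfl

end Correctness

/-- The number of sums of all servers of types in a family of sets. -/
theorem card_sums {α β : ℕ → ℕ} (p : Finset (Fin M) → Prop) [DecidablePred p] :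
    Fintype.card {y : (i : Fin N) × Sums T M α β i // p y.2.1.1} =
      ∑ Λ with Λ.Nonempty ∧ p Λ, ∑ i : Fin N, sumCount T α β Λ.card i := by
  calc _ = ∑ i : Fin N, ∑ Λ : {Λ : Finset (Fin M) // Λ.Nonempty},
          if p Λ.1 then sumCount T α β Λ.1.card i else 0 := by
        rw [Fintype.card_subtype, Finset.card_filter, Fintype.sum_sigma]
        refine Finset.sum_congr rfl fun i _ => ?_
        rw [Fintype.sum_sigma]
        refine Finset.sum_congr rfl fun Λ _ => ?_
        simp only [Finset.sum_boole, Nat.cast_id]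
        split_ifs <;> simp [*]
    _ = ∑ Λ : {Λ : Finset (Fin M) // Λ.Nonempty},
          if p Λ.1 then ∑ i : Fin N, sumCount T α β Λ.1.card i else 0 := by
        rw [Finset.sum_comm]
        refine Finset.sum_congr rfl fun Λ _ => ?_
        split_ifs <;> simp
    _ = ∑ Λ with Λ.Nonempty, if p Λ then ∑ i : Fin N, sumCount T α β Λ.card i else 0 :=
        (Finset.sum_subtype _ (by simp)
          fun Λ => if p Λ then ∑ i : Fin N, sumCount T α β Λ.card i else 0).symm
    _ = _ := by rw [← Finset.filter_filter, ← Finset.sum_filter]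

theorem sum_sumCount_card (hM : 2 ≤ M) {k : ℕ} (hk : 1 ≤ k)
    (hkM : k ≤ M) : ∑ i : Fin N, sumCount T D.α D.β k i =
      N.gcd T * ((redN N T - redT N T) ^ (k - 1) * redT N T ^ (M - k)) :=
  sum_sumCount hM D.split (fun k h1 h2 => (D.recovery k h1 h2).2.1) hk hkM

/-- After multiplication by n - t, the sums of type Λ number d (n-t)^|Λ| t^(M-|Λ|). The added d t^M
is the missing term of the empty set in the binomial expansion of n^M. -/
theorem card_sums_mul (hTN : T < N) (hM : 2 ≤ M) :
    (redN N T - redT N T) * ∑ i : Fin N, Fintype.card (Sums T M D.α D.β i) + N.gcd T * redT N T ^ M =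
      N.gcd T * redN N T ^ M := by
  have h1 := card_sums (N := N) (T := T) (M := M) (α := D.α) (β := D.β) (fun _ => True)
  rw [Fintype.card_congr (Equiv.subtypeUnivEquiv fun _ => trivial), Fintype.card_sigma] at h1
  have h2 : ∀ Λ ∈ Finset.univ.filter (fun Λ : Finset (Fin M) => Λ.Nonempty ∧ True),
      (redN N T - redT N T) * ∑ i : Fin N, sumCount T D.α D.β Λ.card i =
      N.gcd T * ((redN N T - redT N T) ^ Λ.card * redT N T ^ (M - Λ.card)) := by
    intro Λ hΛ
    have hk : 1 ≤ Λ.card := Finset.card_pos.2 (Finset.mem_filter.1 hΛ).2.1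
    rw [D.sum_sumCount_card hM hk (by simpa using Finset.card_le_univ Λ)]
    obtain ⟨k, hk'⟩ : ∃ k, Λ.card = k + 1 := ⟨Λ.card - 1, by omega⟩
    rw [hk', Nat.add_sub_cancel, pow_succ]
    ring
  have h3 : (Finset.univ.filter fun Λ : Finset (Fin M) => Λ.Nonempty ∧ True) =
      Finset.univ.erase ∅ := by
    ext Λ
    simp [Finset.nonempty_iff_ne_empty]
  have h4 := Finset.sum_pow_mul_eq_add_pow (redN N T - redT N T) (redT N T)
    (Finset.univ : Finset (Fin M))
  rw [Finset.powerset_univ, ← Finset.add_sum_erase _ _ (Finset.mem_univ ∅), Finset.card_univ,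
    Fintype.card_fin, Nat.sub_add_cancel (redT_lt_redN hTN).le, Finset.card_empty, pow_zero,
    one_mul, Nat.sub_zero] at h4
  rw [h1, Finset.mul_sum, Finset.sum_congr rfl h2, h3, ← Finset.mul_sum, ← h4]
  ring

theorem sum_card_sums (hTN : T < N) (hM : 2 ≤ M) :
    (∑ i : Fin N, Fintype.card (Sums T M D.α D.β i) : ℕ) =
      (subpack N T M : ℝ) * ∑ k ∈ Finset.range M, (T / N : ℝ) ^ k := by
  have hN : 0 < N := by omega
  have hlt := redT_lt_redN hTN
  have hn : (redN N T : ℝ) ≠ 0 := by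
    have : redN N T ≠ 0 := by omega
    exact_mod_cast this
  have h1 := D.card_sums_mul hTN hM
  have h2 : ((redN N T : ℝ) - redT N T) * (∑ i : Fin N, Fintype.card (Sums T M D.α D.β i) : ℕ) +
      N.gcd T * redT N T ^ M = N.gcd T * redN N T ^ M := by
    rw [← Nat.cast_sub hlt.le]
    exact_mod_cast h1
  have hx : (redT N T / redN N T : ℝ) ≠ 1 := by
    rw [Ne, div_eq_one_iff_eq hn]
    exact_mod_cast hlt.ne
  have h3 : ((redN N T : ℝ) - redT N T) ≠ 0 := by
    rw [sub_ne_zero]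
    exact_mod_cast hlt.ne'
  obtain ⟨m, rfl⟩ : ∃ m, M = m + 1 := ⟨M - 1, by omega⟩
  rw [subpack_eq hM, div_eq_red hN, geom_sum_eq hx, div_pow, Nat.add_sub_cancel]
  have h4 : (redT N T / redN N T - 1 : ℝ) = -((redN N T : ℝ) - redT N T) / redN N T := by
    field_simp
    ring
  have h5 : (redT N T : ℝ) ^ (m + 1) / redN N T ^ (m + 1) - 1 =
      -((redN N T : ℝ) ^ (m + 1) - redT N T ^ (m + 1)) / redN N T ^ (m + 1) := by
    field_simp
    ring
  rw [h4, h5]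
  push_cast
  field_simp
  push_cast at h2
  linear_combination (redN N T : ℝ) ^ (m + 1) * h2

/-- An answer of r symbols has entropy at most r log q, so the count of sums bounds the download by
exactly the converse bound; uniformity of the answers need not be checked. -/
theorem rate_scheme [Fintype F] (hT : 1 ≤ T) (hTN : T < N) (hM : 2 ≤ M) (θ : Fin M) :
    D.scheme.rate θ = 1 / ∑ k ∈ Finset.range M, (T / N : ℝ) ^ k := by
  refine le_antisymm (D.scheme.rate_le D.scheme_isTPIR hT hTN θ) ?_
  have hlog := Scheme.log_card_pos F
  have hσ := Scheme.geom_pos (N := N) (T := T) θ.pos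
  have hL : (0 : ℝ) < subpack N T M := by
    have h1 : 0 < subpack N T M := by
      have := redT_lt_redN hTN
      have : 0 < N := by omega
      have : 0 < redN N T := by omega
      unfold subpack
      positivity
    exact_mod_cast h1
  have hge := D.scheme.sum_entropy_answer_ge D.scheme_isTPIR hT hTN θ
  have hle : ∀ i, entropy D.scheme.law (fun ω => D.scheme.answer θ ω.1 ω.2 i) ≤
      Fintype.card (Sums T M D.α D.β i) * Real.log (Fintype.card F) := by
    intro i
    have h := pmfEntropy_le_log_card (A := Sums T M D.α D.β i → F)
      (D.scheme.law.map fun ω => D.scheme.answer θ ω.1 ω.2 i)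
    rw [Fintype.card_fun, Nat.cast_pow, Real.log_pow] at h
    exact h
  have hsum := Finset.sum_le_sum fun i (_ : i ∈ Finset.univ) => hle i
  rw [← Finset.sum_mul, ← Nat.cast_sum, D.sum_card_sums hTN hM] at hsum
  rw [Scheme.rate, Scheme.entropy_record, div_le_div_iff₀ hσ (lt_of_lt_of_le (by positivity) hge)]
  linarith

end Design

/-! ### Existence of the numbers of sums -/

/-- Starting from b₀ = 0, the recursion stays non-negative because the prescribed sums u^i t^(m-1-i)
do not decrease in i when t ≤ u. -/
theorem exists_consecutive_sums_of_le {u t : ℕ} (h : t ≤ u) (m : ℕ) : ∃ b : ℕ → ℕ,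
    (∀ i < m, b i + b (i + 1) = u ^ i * t ^ (m - 1 - i)) ∧ u * b 0 ≤ t ^ m ∧ t * b m ≤ u ^ m := by
  let b : ℕ → ℕ := fun i => Nat.rec 0 (fun i x => u ^ i * t ^ (m - 1 - i) - x) i
  have hb : ∀ i, b (i + 1) = u ^ i * t ^ (m - 1 - i) - b i := fun _ => rfl
  have hle : ∀ i < m, b i ≤ u ^ i * t ^ (m - 1 - i) := by
    intro i hi
    cases i with
    | zero => exact Nat.zero_le _
    | succ i =>
      rw [hb]
      refine (Nat.sub_le _ _).trans ?_
      have h1 : m - 1 - i = m - 1 - (i + 1) + 1 := by omega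
      rw [h1, pow_succ, pow_succ]
      calc u ^ i * (t ^ (m - 1 - (i + 1)) * t) = u ^ i * t * t ^ (m - 1 - (i + 1)) := by ring
        _ ≤ u ^ i * u * t ^ (m - 1 - (i + 1)) := by gcongr
  refine ⟨b, fun i hi => ?_, Nat.zero_le _, ?_⟩
  · rw [hb]
    exact Nat.add_sub_of_le (hle i hi)
  · cases m with
    | zero => exact Nat.zero_le _
    | succ m =>
      have h2 : b (m + 1) ≤ u ^ m := by
        rw [hb]
        refine (Nat.sub_le _ _).trans (le_of_eq ?_)
        simp
      calc t * b (m + 1) ≤ u * u ^ m := Nat.mul_le_mul h h2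
        _ = u ^ (m + 1) := by ring

theorem exists_consecutive_sums (u t m : ℕ) : ∃ b : ℕ → ℕ,
    (∀ i < m, b i + b (i + 1) = u ^ i * t ^ (m - 1 - i)) ∧ u * b 0 ≤ t ^ m ∧ t * b m ≤ u ^ m := by
  rcases le_total t u with h | h
  · exact exists_consecutive_sums_of_le h m
  · obtain ⟨b, h1, h2, h3⟩ := exists_consecutive_sums_of_le h m
    -- Reversing the sequence interchanges u and t, and with them the two boundary conditions.
    refine ⟨fun i => b (m - i), fun i hi => ?_, by simpa using h3, by simpa using h2⟩
    have h4 := h1 (m - 1 - i) (by omega)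
    have e1 : m - 1 - i + 1 = m - i := by omega
    have e2 : m - 1 - (m - 1 - i) = i := by omega
    have e3 : m - (i + 1) = m - 1 - i := by omega
    rw [e1, e2] at h4
    simp only [e3]
    rw [add_comm, h4, mul_comm]

/-- The condition on the total is solved by β_k = t b_k and α_k = ℓ_k - (n-t) b_k. The splits then
give α_(k+1) = (n-t) b_k, and both recursions become the same condition on b_k + b_(k+1). The two
boundary inequalities make α_1 and β_M non-negative. -/
theorem exists_counts {N T M : ℕ} (hM : 2 ≤ M) : ∃ α β b : ℕ → ℕ, ∀ k, 1 ≤ k → k < M →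
    α k + α (k + 1) = blockLen N T M k ∧ β k + β (k + 1) = blockLen N T M k ∧
    α k + (redN N T - redT N T) * b k = blockLen N T M k ∧ β k = redT N T * b k := by
  obtain ⟨m, rfl⟩ : ∃ m, M = m + 2 := ⟨M - 2, by omega⟩
  obtain ⟨b, h1, h2, h3⟩ := exists_consecutive_sums (redN N T - redT N T) (redT N T) m
  unfold blockLen
  generalize redN N T - redT N T = u at h1 h2 h3 ⊢
  generalize redT N T = t at h1 h2 h3 ⊢
  refine ⟨fun k => if k = 1 then t ^ m - u * b 0 else u * b (k - 2),
    fun k => if k = m + 2 then u ^ m - t * b m else t * b (k - 1), fun k => b (k - 1), ?_⟩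
  intro k hk hkM
  obtain ⟨i, rfl⟩ : ∃ i, k = i + 1 := ⟨k - 1, by omega⟩
  have hα : (if i + 1 = 1 then t ^ m - u * b 0 else u * b (i + 1 - 2)) + u * b i =
      u ^ i * t ^ (m - i) := by
    cases i with
    | zero => simpa using Nat.sub_add_cancel h2
    | succ i =>
      have h4 := h1 i (by omega)
      have e : m - (i + 1) = m - 1 - i := by omega
      rw [if_neg (by omega), e, ← mul_add, pow_succ', mul_assoc, ← h4]
      rfl
  have e0 : m + 2 - 1 - (i + 1) = m - i := by omega
  rw [e0]
  refine ⟨?_, ?_, hα, ?_⟩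
  · simp only [if_neg (show ¬ i + 1 + 1 = 1 by omega)]
    exact hα
  · simp only [Nat.add_sub_cancel]
    rw [if_neg (show ¬ i + 1 = m + 2 by omega)]
    by_cases hi : i = m
    · subst hi
      simpa using Nat.add_sub_of_le h3
    · have h4 := h1 i (by omega)
      have e : m - i = m - 1 - i + 1 := by omega
      rw [if_neg (by omega), e, ← mul_add, h4, pow_succ]
      ring
  · simp only [if_neg (show ¬ i + 1 = m + 2 by omega)]

theorem sum_sumCount_eq {N T : ℕ} (hTN : T < N) (α β : ℕ → ℕ) (k : ℕ) :
    ∑ i : Fin N, sumCount T α β k i = T * α k + (N - T) * β k := by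
  obtain ⟨c, rfl⟩ : ∃ c, N = T + c := ⟨N - T, by omega⟩
  have h1 : ∀ i : Fin T, sumCount T α β k (Fin.castAdd c i) = α k := fun i => by simp [sumCount]
  have h2 : ∀ i : Fin c, sumCount T α β k (Fin.natAdd T i) = β k := fun i => by simp [sumCount]
  rw [Fin.sum_univ_add]
  simp [h1, h2]

theorem sum_sumCount_of_counts {N T M k : ℕ} (hTN : T < N) {α β b : ℕ → ℕ}
    (hα : α k + (redN N T - redT N T) * b k = blockLen N T M k) (hβ : β k = redT N T * b k) :
    ∑ i : Fin N, sumCount T α β k i = T * blockLen N T M k := by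
  rw [sum_sumCount_eq hTN, hβ, ← hα, ← sub_mul_gcd, mul_add]
  congr 1
  calc _ = redT N T * N.gcd T * ((redN N T - redT N T) * b k) := by ring
    _ = _ := by rw [redT_mul_gcd]

/-! ### Rado's theorem -/

section Rado

variable {F E : Type} [Field F] [AddCommGroup E] [Module F E]

/-- As long as some set has two elements x ≠ y, one of them can be deleted without violating the
rank condition. When all sets are singletons, the condition for the whole family is linear
independence. -/
theorem rado {ι : Type} [Fintype ι] (A : ι → Finset E)
    (h : ∀ J : Finset ι, J.card ≤
      Module.finrank F (⨆ i ∈ J, Submodule.span F (A i : Set E) : Submodule F E)) :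
    ∃ x : ι → E, (∀ i, x i ∈ A i) ∧ LinearIndependent F x := by
  classical
  induction hn : ∑ i, (A i).card using Nat.strong_induction_on generalizing A with
  | _ n ih =>
    by_cases hex : ∃ i, 1 < (A i).card
    · obtain ⟨i, hi⟩ := hex
      obtain ⟨x, hx, y, hy, hxy⟩ := Finset.one_lt_card.1 hi
      have hsum : ∀ z ∈ A i, ∑ i', (Function.update A i ((A i).erase z) i').card < n := by
        intro z hz
        rw [← hn]
        refine Finset.sum_lt_sum (fun i' _ => ?_) ⟨i, Finset.mem_univ i, ?_⟩
        · by_cases h' : i' = i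
          · subst h'
            rw [Function.update_self]
            exact Finset.card_le_card (Finset.erase_subset _ _)
          · rw [Function.update_of_ne h']
        · rw [Function.update_self]
          exact Finset.card_erase_lt_of_mem hz
      have hdone : ∀ z ∈ A i, (∀ J : Finset ι, J.card ≤ Module.finrank F
          (⨆ i' ∈ J, Submodule.span F (Function.update A i ((A i).erase z) i' : Set E) :
            Submodule F E)) → ∃ x : ι → E, (∀ i, x i ∈ A i) ∧ LinearIndependent F x := by
        intro z hz hJ
        obtain ⟨w, hw, hli⟩ := ih _ (hsum z hz) _ hJ rfl
        refine ⟨w, fun i' => ?_, hli⟩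
        have := hw i'
        by_cases h' : i' = i
        · subst h'
          rw [Function.update_self] at this
          exact Finset.mem_of_mem_erase this
        · rwa [Function.update_of_ne h'] at this
      -- a violated condition for the family without `z`
      have hviol : ∀ z, ¬ (∀ J : Finset ι, J.card ≤ Module.finrank F
          (⨆ i' ∈ J, Submodule.span F (Function.update A i ((A i).erase z) i' : Set E) :
            Submodule F E)) → ∃ K : Finset ι, i ∉ K ∧ Module.finrank F
          (Submodule.span F ((A i).erase z : Set E) ⊔ ⨆ i' ∈ K, Submodule.span F (A i' : Set E) :
            Submodule F E) ≤ K.card := by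
        intro z hz
        push Not at hz
        obtain ⟨J, hJ⟩ := hz
        have hK : ∀ K : Finset ι, i ∉ K →
            (⨆ i' ∈ K, Submodule.span F (Function.update A i ((A i).erase z) i' : Set E)) =
              ⨆ i' ∈ K, Submodule.span F (A i' : Set E) := by
          intro K hK
          refine biSup_congr fun i' hi' => ?_
          rw [Function.update_of_ne (ne_of_mem_of_not_mem hi' hK)]
        by_cases hiJ : i ∈ J
        · refine ⟨J.erase i, Finset.notMem_erase i J, ?_⟩
          rw [← Finset.insert_erase hiJ, Finset.iSup_insert, Function.update_self,
            hK _ (Finset.notMem_erase i J),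
            Finset.card_insert_of_notMem (Finset.notMem_erase i J)] at hJ
          omega
        · rw [hK J hiJ] at hJ
          exact absurd (h J) (by omega)
      have hle : ∀ (K : Finset ι), ∀ i' ∈ K, Submodule.span F (A i' : Set E) ≤
          ⨆ i' ∈ K, Submodule.span F (A i' : Set E) := fun K i' hi' =>
        le_biSup (fun i' => Submodule.span F (A i' : Set E)) hi'
      by_contra hcon
      obtain ⟨K₁, hi₁, hK₁⟩ := hviol x fun hJ => hcon (hdone x hx hJ)
      obtain ⟨K₂, hi₂, hK₂⟩ := hviol y fun hJ => hcon (hdone y hy hJ)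
      -- If deleting x and deleting y both fail, witnessed by K₁ and K₂, the two spans have total
      -- dimension at most |K₁| + |K₂|. Their sum contains everything for {i} ∪ K₁ ∪ K₂ and their
      -- intersection everything for K₁ ∩ K₂, so the condition demands at least one more.
      have hdim := Submodule.finrank_sup_add_finrank_inf_eq
        (Submodule.span F ((A i).erase x : Set E) ⊔ ⨆ i' ∈ K₁, Submodule.span F (A i' : Set E))
        (Submodule.span F ((A i).erase y : Set E) ⊔ ⨆ i' ∈ K₂, Submodule.span F (A i' : Set E))
      have h1 := h (insert i (K₁ ∪ K₂))
      rw [Finset.card_insert_of_notMem (by simp [hi₁, hi₂]), Finset.iSup_insert] at h1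
      have h2 := h (K₁ ∩ K₂)
      have hsup : Submodule.span F (A i : Set E) ⊔
          ⨆ i' ∈ K₁ ∪ K₂, Submodule.span F (A i' : Set E) ≤
          Submodule.span F ((A i).erase x : Set E) ⊔ (⨆ i' ∈ K₁, Submodule.span F (A i' : Set E)) ⊔
          (Submodule.span F ((A i).erase y : Set E) ⊔
            ⨆ i' ∈ K₂, Submodule.span F (A i' : Set E)) := by
        refine sup_le (Submodule.span_le.2 fun z hz => ?_) (iSup₂_le fun i' hi' => ?_)
        · by_cases hzx : z = x
          · exact Submodule.mem_sup_right (Submodule.mem_sup_left (Submodule.subset_span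
              (by simpa [hzx, hxy] using hx)))
          · exact Submodule.mem_sup_left (Submodule.mem_sup_left (Submodule.subset_span
              (by simpa [hzx] using hz)))
        · rcases Finset.mem_union.1 hi' with h' | h'
          · exact (hle _ i' h').trans (le_sup_right.trans le_sup_left)
          · exact (hle _ i' h').trans (le_sup_right.trans le_sup_right)
      have hinf : ⨆ i' ∈ K₁ ∩ K₂, Submodule.span F (A i' : Set E) ≤
          (Submodule.span F ((A i).erase x : Set E) ⊔ ⨆ i' ∈ K₁, Submodule.span F (A i' : Set E)) ⊓
          (Submodule.span F ((A i).erase y : Set E) ⊔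
            ⨆ i' ∈ K₂, Submodule.span F (A i' : Set E)) := by
        refine iSup₂_le fun i' hi' => le_inf ?_ ?_
        · exact (hle _ i' (Finset.mem_inter.1 hi').1).trans le_sup_right
        · exact (hle _ i' (Finset.mem_inter.1 hi').2).trans le_sup_right
      have h3 := Submodule.finrank_mono hsup
      have h4 := Submodule.finrank_mono hinf
      have h5 := Finset.card_union_add_card_inter K₁ K₂
      omega
    · push Not at hex
      have hne : ∀ i, (A i).Nonempty := by
        intro i
        by_contra he
        have h1 := h {i}
        rw [Finset.not_nonempty_iff_eq_empty] at he
        simp [he] at h1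
      choose x hx using hne
      have hA : ∀ i, A i = {x i} := fun i =>
        (Finset.eq_of_subset_of_card_le (Finset.singleton_subset_iff.2 (hx i))
          (by simpa using hex i)).symm
      refine ⟨x, hx, ?_⟩
      rw [linearIndependent_iff_card_le_finrank_span]
      have h1 : (⨆ i ∈ Finset.univ, Submodule.span F (A i : Set E)) =
          Submodule.span F (Set.range x) := by
        simp only [hA, Finset.mem_univ, iSup_pos, Finset.coe_singleton, ← Submodule.span_iUnion,
          Set.iUnion_singleton_eq_range]
      have h2 := h Finset.univ
      rwa [h1, Finset.card_univ] at h2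

end Rado

/-! ### MDS array codes with the recovery property -/

section Codes

variable {F : Type} [Field F]

theorem exists_extension_field (F : Type) [Field F] [Fintype F] {ℓ : ℕ} (hℓ : 0 < ℓ) :
    ∃ (K : Type) (_ : Field K) (_ : Fintype K) (_ : Algebra F K),
      Module.finrank F K = ℓ ∧ Fintype.card K = Fintype.card F ^ ℓ := by
  obtain ⟨p, hp⟩ := CharP.exists F
  have : Fact p.Prime := ⟨CharP.char_is_prime F p⟩
  have : NeZero ℓ := ⟨hℓ.ne'⟩
  refine ⟨FiniteField.Extension F p ℓ, inferInstance, Fintype.ofFinite _, inferInstance,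
    FiniteField.finrank_extension F p ℓ, ?_⟩
  have := FiniteField.natCard_extension F p ℓ
  rwa [Nat.card_eq_fintype_card (α := F), @Nat.card_eq_fintype_card _ (Fintype.ofFinite _)] at this

/-- The thick columns of an MDS array code, as subspaces. -/
theorem exists_mds_subspaces (F : Type) [Field F] [Fintype F] {N T ℓ : ℕ} (hT : 1 ≤ T)
    (hℓ : 0 < ℓ) (hN : N ≤ Fintype.card F ^ ℓ) :
    ∃ V : Fin N → Submodule F (Fin (T * ℓ) → F), (∀ i, Module.finrank F (V i) = ℓ) ∧
      ∀ Γ : Finset (Fin N), Γ.card = T → ⨆ i ∈ Γ, V i = ⊤ := by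
  obtain ⟨K, _, _, _, hfin, hcard⟩ := exists_extension_field F hℓ
  obtain ⟨a⟩ : Nonempty (Fin N ↪ K) := Function.Embedding.nonempty_of_card_le (by
    rw [Fintype.card_fin, hcard]
    exact hN)
  have : FiniteDimensional F K := Module.Finite.of_finite
  let e : (Fin T → K) ≃ₗ[F] (Fin (T * ℓ) → F) := LinearEquiv.ofFinrankEq _ _ (by
    rw [Module.finrank_pi_fintype]
    simp [hfin])
  -- The thick column is the K-line of (1, a_i, …, a_i^(T-1)), of dimension ℓ over F. Any T such
  -- lines span by Vandermonde; the N distinct points a_i require N ≤ q^ℓ.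
  let φ : Fin N → K →ₗ[F] (Fin T → K) := fun i =>
    LinearMap.pi fun r => LinearMap.mulRight F (a i ^ (r : ℕ))
  have hφ : ∀ i, Function.Injective (φ i) := by
    intro i c c' h
    have := congrFun h ⟨0, hT⟩
    simpa [φ] using this
  refine ⟨fun i => LinearMap.range ((e : (Fin T → K) →ₗ[F] _) ∘ₗ φ i), fun i => ?_, fun Γ hΓ => ?_⟩
  · rw [LinearMap.finrank_range_of_inj, hfin]
    exact e.injective.comp (hφ i)
  · rw [eq_top_iff]
    rintro w -
    let f := Γ.equivFinOfCardEq hΓ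
    have hdet : (Matrix.vandermonde fun r : Fin T => a (f.symm r)).det ≠ 0 := by
      rw [Matrix.det_vandermonde_ne_zero_iff]
      exact a.injective.comp (Subtype.val_injective.comp f.symm.injective)
    set A := Matrix.vandermonde fun r : Fin T => a (f.symm r) with hA
    have hw : w = ∑ r, e (φ (f.symm r) ((e.symm w ᵥ* A⁻¹) r)) := by
      rw [← map_sum]
      have h1 : ∑ r, φ (f.symm r) ((e.symm w ᵥ* A⁻¹) r) = (e.symm w ᵥ* A⁻¹) ᵥ* A := by
        ext s
        simp [φ, Matrix.vecMul, dotProduct, hA, Matrix.vandermonde_apply, Finset.sum_mul]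
      rw [h1, Matrix.vecMul_vecMul, Matrix.nonsing_inv_mul _ (Ne.isUnit hdet), Matrix.vecMul_one,
        e.apply_symm_apply]
    rw [hw]
    refine Submodule.sum_mem _ fun r _ => ?_
    exact Submodule.mem_iSup_of_mem (f.symm r).1 (Submodule.mem_iSup_of_mem (f.symm r).2
      ⟨_, rfl⟩)

theorem finrank_iSup_le_add {E : Type} [AddCommGroup E] [Module F E] [FiniteDimensional F E]
    {ι : Type} [DecidableEq ι] (V : ι → Submodule F E) {ℓ : ℕ}
    (hV : ∀ i, Module.finrank F (V i) ≤ ℓ) (I J : Finset ι) :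
    Module.finrank F (⨆ i ∈ I ∪ J, V i : Submodule F E) ≤
      Module.finrank F (⨆ i ∈ I, V i : Submodule F E) + J.card * ℓ := by
  induction J using Finset.induction_on with
  | empty => rw [Finset.union_empty, Finset.card_empty, zero_mul, add_zero]
  | insert j J hj ih =>
    rw [Finset.union_insert, Finset.iSup_insert, Finset.card_insert_of_notMem hj]
    have h1 := Submodule.finrank_add_le_finrank_add_finrank (V j) (⨆ i ∈ I ∪ J, V i)
    have h2 := hV j
    have h3 : (J.card + 1) * ℓ = J.card * ℓ + ℓ := by ring
    omega

theorem exists_basis_extending {E : Type} [AddCommGroup E] [Module F E] [FiniteDimensional F E]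
    {m ℓ : ℕ} (hm : m ≤ ℓ) {V : Submodule F E} (hV : Module.finrank F V = ℓ) {x : Fin m → E}
    (hx : ∀ r, x r ∈ V) (hli : LinearIndependent F x) :
    ∃ g : Fin ℓ → E, (∀ r, g (Fin.castLE hm r) = x r) ∧ Submodule.span F (Set.range g) = V := by
  let v : Fin m → V := fun r => ⟨x r, hx r⟩
  have hv : LinearIndependent F v := LinearIndependent.of_comp V.subtype hli
  let b : Module.Basis (Fin ℓ) F V := Module.finBasisOfFinrankEq F V hV
  have hu : LinearIndependent F fun r : Fin m => b (Fin.castLE hm r) :=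
    b.linearIndependent.comp _ (Fin.castLE_injective hm)
  obtain ⟨g, hg⟩ := Submodule.exists_linearEquiv_restrict_eq
    ((Module.Basis.span hu).equiv (Module.Basis.span hv) (Equiv.refl _))
  refine ⟨fun c => (b.map g c : V), fun r => ?_, ?_⟩
  · have h3 := hg (Module.Basis.span hu r)
    rw [Module.Basis.equiv_apply, Equiv.refl_apply, Module.Basis.span_apply,
      Module.Basis.span_apply] at h3
    exact congrArg Subtype.val h3.symm
  · have h4 := congrArg (Submodule.map V.subtype) (b.map g).span_eq
    rw [Submodule.map_top, Submodule.range_subtype, Submodule.map_span, ← Set.range_comp] at h4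
    exact h4

/-- The MDS property depends only on the column spaces V_i, so their bases may be chosen freely:
Rado's theorem selects the first m_i vectors in each V_i, and these are completed to bases. -/
theorem exists_mds_recovery (F : Type) [Field F] [Fintype F] {N T ℓ : ℕ} (hT : 1 ≤ T)
    (hTN : T < N) (hℓ : 0 < ℓ) (hN : N ≤ Fintype.card F ^ ℓ) {m : Fin N → ℕ} (hm : ∀ i, m i ≤ ℓ)
    (hsum : ∑ i, m i = T * ℓ) :
    ∃ G : Matrix (Fin (T * ℓ)) (Fin N × Fin ℓ) F, IsMDSArrayGenerator G ∧ HasRecovery G m := by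
  classical
  obtain ⟨V, hV, htop⟩ := exists_mds_subspaces F hT hℓ hN
  let B : Fin N → Finset (Fin (T * ℓ) → F) := fun i =>
    Finset.univ.image fun c => ((Module.finBasisOfFinrankEq F (V i) (hV i) c : V i) : _ → F)
  have hB : ∀ i, Submodule.span F (B i : Set (Fin (T * ℓ) → F)) = V i := by
    intro i
    have h4 := congrArg (Submodule.map (V i).subtype)
      (Module.finBasisOfFinrankEq F (V i) (hV i)).span_eq
    rw [Submodule.map_top, Submodule.range_subtype, Submodule.map_span, ← Set.range_comp] at h4
    have h5 : (B i : Set (Fin (T * ℓ) → F)) =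
        Set.range ((V i).subtype ∘ Module.finBasisOfFinrankEq F (V i) (hV i)) := by
      simp only [B, Finset.coe_image, Finset.coe_univ, Set.image_univ]
      rfl
    rw [h5]
    exact h4
  -- At least T of the V_i span everything. For fewer, the span has dimension at least |I| ℓ, since
  -- completing I to a T-set adds at most ℓ per element.
  have hrank : ∀ I : Finset (Fin N), ∑ i ∈ I, m i ≤
      Module.finrank F (⨆ i ∈ I, V i : Submodule F (Fin (T * ℓ) → F)) := by
    intro I
    rcases le_total T I.card with h | h
    · obtain ⟨Γ, hΓI, hΓ⟩ := Finset.exists_subset_card_eq h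
      have h1 : ⨆ i ∈ I, V i = ⊤ :=
        top_le_iff.1 ((htop Γ hΓ).symm.le.trans (biSup_mono fun i hi => hΓI hi))
      rw [h1, finrank_top, Module.finrank_fin_fun, ← hsum]
      exact Finset.sum_le_sum_of_subset (Finset.subset_univ I)
    · obtain ⟨Γ, hIΓ, -, hΓ⟩ := Finset.exists_subsuperset_card_eq (Finset.subset_univ I) h
        (by simpa using hTN.le)
      have h1 := finrank_iSup_le_add V (fun i => (hV i).le) I (Γ \ I)
      rw [Finset.union_sdiff_of_subset hIΓ, htop Γ hΓ, finrank_top, Module.finrank_fin_fun,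
        Finset.card_sdiff_of_subset hIΓ, hΓ, Nat.sub_mul] at h1
      have h2 : ∑ i ∈ I, m i ≤ I.card * ℓ := by
        rw [← smul_eq_mul]
        exact Finset.sum_le_card_nsmul _ _ _ fun i _ => hm i
      have h3 : I.card * ℓ ≤ T * ℓ := Nat.mul_le_mul_right ℓ h
      omega
  -- The basis of V_i occurs m_i times in the family.
  obtain ⟨x, hxB, hx⟩ := rado (F := F) (ι := (i : Fin N) × Fin (m i)) (fun y => B y.1) (by
    intro J
    have h1 : (⨆ y ∈ J, Submodule.span F (B y.1 : Set (Fin (T * ℓ) → F))) =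
        ⨆ i ∈ J.image Sigma.fst, V i := by
      simp only [hB]
      rw [Finset.iSup_finset_image]
    rw [h1]
    refine le_trans ?_ (hrank _)
    have h2 : J ⊆ (J.image Sigma.fst).sigma fun i => (Finset.univ : Finset (Fin (m i))) := by
      intro y hy
      simp only [Finset.mem_sigma, Finset.mem_univ, and_true]
      exact Finset.mem_image_of_mem _ hy
    refine (Finset.card_le_card h2).trans (le_of_eq ?_)
    simp [Finset.card_sigma])
  have hg : ∀ i, ∃ g : Fin ℓ → Fin (T * ℓ) → F,
      (∀ r, g (Fin.castLE (hm i) r) = x ⟨i, r⟩) ∧ Submodule.span F (Set.range g) = V i := by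
    intro i
    refine exists_basis_extending (hm i) (hV i) (fun r => ?_)
      (hx.comp (fun r : Fin (m i) => (⟨i, r⟩ : (i : Fin N) × Fin (m i)))
        (sigma_mk_injective (β := fun i => Fin (m i))))
    rw [← hB i]
    exact Submodule.subset_span (hxB ⟨i, r⟩)
  choose g hgx hgV using hg
  refine ⟨Matrix.of fun r c => g c.1 c.2 r, ⟨hTN, fun Γ hΓ => ?_⟩, hm, hsum, ?_⟩
  · rw [Matrix.rank_eq_finrank_span_cols]
    have h1 : Submodule.span F (Set.range ((Matrix.of fun r c => g c.1 c.2 r).submatrix id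
        (fun c : Γ × Fin ℓ => ((c.1 : Fin N), c.2))).col) = ⊤ := by
      rw [← top_le_iff, ← htop Γ hΓ]
      refine iSup₂_le fun i hi => ?_
      rw [← hgV i]
      refine Submodule.span_mono ?_
      rintro _ ⟨c, rfl⟩
      exact ⟨(⟨i, hi⟩, c), funext fun _ => rfl⟩
    rw [h1, finrank_top, Module.finrank_fin_fun]
  · refine le_antisymm ((Matrix.rank_le_card_height _).trans_eq (Fintype.card_fin _)) ?_
    rw [Matrix.rank_eq_finrank_span_cols]
    have h1 : Module.finrank F (Submodule.span F (Set.range x)) = T * ℓ := by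
      rw [finrank_span_eq_card hx]
      simp [hsum]
    refine h1.symm.le.trans (Submodule.finrank_mono (Submodule.span_mono ?_))
    rintro _ ⟨⟨i, r⟩, rfl⟩
    exact ⟨⟨(i, Fin.castLE (hm i) r), r.2⟩, hgx i r⟩

end Codes

/-! ### Existence of designs -/

theorem subpack_pos {N T : ℕ} (hTN : T < N) (M : ℕ) : 0 < subpack N T M := by
  have h1 : 0 < N := by omega
  have h2 : 0 < redN N T := lt_of_le_of_lt (Nat.zero_le _) (redT_lt_redN hTN)
  unfold subpack
  positivity

/-- Summing d (n-t)^|Λ| t^(M-1-|Λ|) over the sets Λ avoiding θ gives d n^(M-1), which is the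
sub-packetization. -/
theorem card_desired {N T M : ℕ} (hTN : T < N) (hM : 2 ≤ M) {α β : ℕ → ℕ}
    (hcount : ∀ k, 1 ≤ k → k ≤ M → ∑ i : Fin N, sumCount T α β k i =
      N.gcd T * ((redN N T - redT N T) ^ (k - 1) * redT N T ^ (M - k))) (θ : Fin M) :
    Fintype.card {y : (i : Fin N) × Sums T M α β i // θ ∈ y.2.1.1} = subpack N T M := by
  rw [Design.card_sums fun Λ => θ ∈ Λ]
  have h1 : ∑ Λ : Finset (Fin M) with Λ.Nonempty ∧ θ ∈ Λ, ∑ i : Fin N, sumCount T α β Λ.card i =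
      ∑ Λ ∈ (Finset.univ.erase θ).powerset, N.gcd T * ((redN N T - redT N T) ^ Λ.card *
        redT N T ^ ((Finset.univ.erase θ).card - Λ.card)) := by
    symm
    refine Finset.sum_bij' (fun Λ _ => insert θ Λ) (fun Λ _ => Λ.erase θ) ?_ ?_ ?_ ?_ ?_
    · intro Λ _
      simp
    · intro Λ _
      exact Finset.mem_powerset.2 (Finset.erase_subset_erase _ (Finset.subset_univ _))
    · intro Λ hΛ
      exact Finset.erase_insert fun h => by simpa using Finset.mem_powerset.1 hΛ h
    · intro Λ hΛ
      exact Finset.insert_erase (Finset.mem_filter.1 hΛ).2.2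
    · intro Λ hΛ
      have hθ : θ ∉ Λ := fun h => by simpa using Finset.mem_powerset.1 hΛ h
      have hc : Λ.card < M := by simpa using Finset.card_lt_univ_of_notMem hθ
      have e : M - 1 - Λ.card = M - (Λ.card + 1) := by omega
      rw [Finset.card_insert_of_notMem hθ, hcount _ (by omega) (by omega),
        Finset.card_erase_of_mem (Finset.mem_univ θ), Finset.card_univ, Fintype.card_fin, e,
        Nat.add_sub_cancel]
  rw [h1, ← Finset.mul_sum, Finset.sum_pow_mul_eq_add_pow,
    Nat.sub_add_cancel (redT_lt_redN hTN).le, Finset.card_erase_of_mem (Finset.mem_univ θ),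
    Finset.card_univ, Fintype.card_fin, subpack_eq hM]

/-- The binomial theorem over the M - 2 records other than θ and j gives T n^(M-2), less than the
available N n^(M-2) columns. -/
theorem card_side {N T M : ℕ} (hTN : T < N) {θ j : Fin M} (hj : j ≠ θ) :
    Fintype.card {x : (Λ : Finset (Fin M)) × Fin (T * blockLen N T M Λ.card) //
      j ∈ x.1 ∧ θ ∉ x.1} ≤ subpack N T M := by
  have h0 : Fintype.card {x : (Λ : Finset (Fin M)) × Fin (T * blockLen N T M Λ.card) //
      j ∈ x.1 ∧ θ ∉ x.1} = ∑ Λ : Finset (Fin M) with j ∈ Λ ∧ θ ∉ Λ, T * blockLen N T M Λ.card := by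
    rw [Fintype.card_subtype, Finset.card_filter, Fintype.sum_sigma, Finset.sum_filter]
    refine Finset.sum_congr rfl fun Λ _ => ?_
    split_ifs <;> simp [*]
  set U : Finset (Fin M) := (Finset.univ.erase θ).erase j with hU
  have hUc : U.card = M - 2 := by
    rw [hU, Finset.card_erase_of_mem (Finset.mem_erase.2 ⟨hj, Finset.mem_univ j⟩),
      Finset.card_erase_of_mem (Finset.mem_univ θ), Finset.card_univ, Fintype.card_fin]
    omega
  have h1 : ∑ Λ : Finset (Fin M) with j ∈ Λ ∧ θ ∉ Λ, T * blockLen N T M Λ.card =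
      ∑ Λ ∈ U.powerset, T * ((redN N T - redT N T) ^ Λ.card * redT N T ^ (U.card - Λ.card)) := by
    symm
    refine Finset.sum_bij' (fun Λ _ => insert j Λ) (fun Λ _ => Λ.erase j) ?_ ?_ ?_ ?_ ?_
    · intro Λ hΛ
      have : θ ∉ Λ := fun h => by simpa [hU] using Finset.mem_powerset.1 hΛ h
      simp [this, hj.symm]
    · intro Λ hΛ
      have := (Finset.mem_filter.1 hΛ).2
      refine Finset.mem_powerset.2 (Finset.erase_subset_erase _ fun x hx => ?_)
      exact Finset.mem_erase.2 ⟨fun h => this.2 (h ▸ hx), Finset.mem_univ x⟩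
    · intro Λ hΛ
      exact Finset.erase_insert fun h => by simpa [hU] using Finset.mem_powerset.1 hΛ h
    · intro Λ hΛ
      exact Finset.insert_erase (Finset.mem_filter.1 hΛ).2.1
    · intro Λ hΛ
      have hjΛ : j ∉ Λ := fun h => by simpa [hU] using Finset.mem_powerset.1 hΛ h
      have e : M - 1 - (Λ.card + 1) = M - 2 - Λ.card := by omega
      rw [Finset.card_insert_of_notMem hjΛ, blockLen, hUc, e, Nat.add_sub_cancel]
  rw [h0, h1, ← Finset.mul_sum, Finset.sum_pow_mul_eq_add_pow,
    Nat.sub_add_cancel (redT_lt_redN hTN).le, hUc, subpack]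
  exact Nat.mul_le_mul_right _ hTN.le

/-- ℓ_k is a product of M - 2 factors, each t or n - t. Hence one bound on q serves all M - 1 codes.
-/
theorem min_le_blockLen {N T M k : ℕ} (hk : 1 ≤ k) (hkM : k < M) :
    min (redT N T ^ (M - 2)) ((redN N T - redT N T) ^ (M - 2)) ≤ blockLen N T M k := by
  have e : M - 2 = (k - 1) + (M - 1 - k) := by omega
  rw [blockLen, e]
  rcases le_total (redN N T - redT N T) (redT N T) with h | h
  · refine (min_le_right _ _).trans ?_
    rw [pow_add]
    gcongr
  · refine (min_le_left _ _).trans ?_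
    rw [pow_add]
    gcongr

theorem exists_bijOn_of_card {A : Type} [Fintype A] {p : A → Prop} [DecidablePred p] {n : ℕ}
    (hn : 0 < n) (h : Fintype.card {a // p a} = n) :
    ∃ f : A → Fin n, Set.BijOn f {a | p a} Set.univ := by
  let e := Fintype.equivFinOfCardEq h
  have hf : ∀ a (ha : p a), (if h : p a then e ⟨a, h⟩ else ⟨0, hn⟩) = e ⟨a, ha⟩ :=
    fun a ha => dif_pos ha
  refine ⟨fun a => if h : p a then e ⟨a, h⟩ else ⟨0, hn⟩, fun _ _ => Set.mem_univ _, ?_, ?_⟩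
  · intro a ha b hb hab
    simp only [hf a ha, hf b hb] at hab
    exact congrArg Subtype.val (e.injective hab)
  · intro b _
    refine ⟨(e.symm b).1, (e.symm b).2, ?_⟩
    simp only [hf _ (e.symm b).2]
    exact e.apply_symm_apply b

theorem exists_injOn_of_card {A : Type} [Fintype A] {p : A → Prop} [DecidablePred p] {n : ℕ}
    (hn : 0 < n) (h : Fintype.card {a // p a} ≤ n) :
    ∃ f : A → Fin n, Set.InjOn f {a | p a} := by
  obtain ⟨e⟩ : Nonempty ({a // p a} ↪ Fin n) :=
    Function.Embedding.nonempty_of_card_le (by simpa using h)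
  have hf : ∀ a (ha : p a), (if h : p a then e ⟨a, h⟩ else ⟨0, hn⟩) = e ⟨a, ha⟩ :=
    fun a ha => dif_pos ha
  refine ⟨fun a => if h : p a then e ⟨a, h⟩ else ⟨0, hn⟩, ?_⟩
  intro a ha b hb hab
  simp only [hf a ha, hf b hb] at hab
  exact congrArg Subtype.val (e.injective hab)

theorem nonempty_design (F : Type) [Field F] [Fintype F] {N T M : ℕ} (hT : 1 ≤ T) (hTN : T < N)
    (hM : 2 ≤ M) (hq : N ≤ Fintype.card F ^
      min (redT N T ^ (M - 2)) ((redN N T - redT N T) ^ (M - 2))) :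
    Nonempty (Design F N T M) := by
  obtain ⟨α, β, b, hb⟩ := exists_counts (N := N) (T := T) hM
  have hsplit : ∀ k, 1 ≤ k → k < M → ∀ i : Fin N,
      sumCount T α β k i + sumCount T α β (k + 1) i = blockLen N T M k := by
    intro k h1 h2 i
    unfold sumCount
    split_ifs
    · exact (hb k h1 h2).1
    · exact (hb k h1 h2).2.1
  have hsum : ∀ k, 1 ≤ k → k < M → ∑ i : Fin N, sumCount T α β k i = T * blockLen N T M k :=
    fun k h1 h2 => sum_sumCount_of_counts hTN (hb k h1 h2).2.2.1 (hb k h1 h2).2.2.2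
  have hG : ∀ k, ∃ G : Matrix (Fin (T * blockLen N T M k)) (Fin N × Fin (blockLen N T M k)) F,
      1 ≤ k → k < M → IsMDSArrayGenerator G ∧ HasRecovery G (sumCount T α β k) := by
    intro k
    by_cases hk : 1 ≤ k ∧ k < M
    · have hpos : 0 < blockLen N T M k := by
        have h1 : 0 < redT N T := redT_pos hT
        have h2 : 0 < redN N T - redT N T := Nat.sub_pos_of_lt (redT_lt_redN hTN)
        unfold blockLen
        positivity
      obtain ⟨G, h1, h2⟩ := exists_mds_recovery F hT hTN hpos
        (hq.trans (Nat.pow_le_pow_right Fintype.card_pos (min_le_blockLen hk.1 hk.2)))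
        (m := sumCount T α β k) (fun i => by have := hsplit k hk.1 hk.2 i; omega)
        (hsum k hk.1 hk.2)
      exact ⟨G, fun _ _ => ⟨h1, h2⟩⟩
    · exact ⟨0, fun h1 h2 => absurd ⟨h1, h2⟩ hk⟩
  choose G hG using hG
  have hd : ∀ θ : Fin M, ∃ f : ((i : Fin N) × Sums T M α β i) → Fin (subpack N T M),
      Set.BijOn f {x | θ ∈ x.2.1.1} Set.univ := fun θ =>
    exists_bijOn_of_card (subpack_pos hTN M)
      (card_desired hTN hM (fun k h1 h2 => sum_sumCount hM hsplit hsum h1 h2) θ)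
  choose f hf using hd
  have hs : ∀ θ j : Fin M, ∃ f : ((Λ : Finset (Fin M)) × Fin (T * blockLen N T M Λ.card)) →
      Fin (subpack N T M), j ≠ θ → Set.InjOn f {x | j ∈ x.1 ∧ θ ∉ x.1} := by
    intro θ j
    by_cases hj : j = θ
    · exact ⟨fun _ => ⟨0, subpack_pos hTN M⟩, fun h => absurd hj h⟩
    · obtain ⟨f, hf⟩ := exists_injOn_of_card (subpack_pos hTN M) (card_side hTN hj)
      exact ⟨f, fun _ => hf⟩
  choose g hg using hs
  exact ⟨{ α := α
           β := β
           split := hsplit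
           G := G
           mds := fun k h1 h2 => (hG k h1 h2).1
           recovery := fun k h1 h2 => (hG k h1 h2).2
           desiredCol := f
           desiredCol_bij := hf
           sideCol := g
           sideCol_inj := hg }⟩

theorem le_pow_of_rpow_le {N q ℓ : ℕ} (hℓ : 0 < ℓ)
    (h : (N : ℝ) ^ ((1 : ℝ) / (ℓ : ℝ)) ≤ (q : ℝ)) : N ≤ q ^ ℓ := by
  have h1 := pow_le_pow_left₀ (by positivity) h ℓ
  rw [one_div, Real.rpow_inv_natCast_pow (Nat.cast_nonneg N) hℓ.ne'] at h1
  exact_mod_cast h1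

end TPIR

/-! ### The main theorem -/

theorem mainTheorem1 (F : Type) [Field F] [Fintype F] (N T M : ℕ)
    (hT : 1 ≤ T) (hTN : T < N) (hM : 2 ≤ M)
    (hq : (N : ℝ) ^ ((1 : ℝ) /
        ((min (TPIR.redT N T ^ (M - 2)) ((TPIR.redN N T - TPIR.redT N T) ^ (M - 2)) : ℕ) : ℝ))
      ≤ (Fintype.card F : ℝ)) :
    -- the value of the capacity
    TPIR.IsCapacity N T M ((1 - (T : ℝ) / N) / (1 - ((T : ℝ) / N) ^ M)) ∧
    -- the required MDS array codes, and so the scheme, exist over `F`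
    Nonempty (TPIR.Design F N T M) ∧
    -- the scheme is a linear capacity-achieving `T`-PIR scheme with record length `N n^(M-2)`
    (∀ D : TPIR.Design F N T M, TPIR.IsLinearCapacityAchieving D.scheme T) ∧
    -- this sub-packetization is optimal among linear capacity-achieving `T`-PIR schemes
    (∀ (K : Type) [Field K] [Fintype K] (L : ℕ) (S : TPIR.Scheme K N M L),
      TPIR.IsLinearCapacityAchieving S T → TPIR.subpack N T M ≤ L) := by
  have hℓ : 0 < min (TPIR.redT N T ^ (M - 2)) ((TPIR.redN N T - TPIR.redT N T) ^ (M - 2)) :=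
    lt_min (pow_pos (TPIR.redT_pos hT) _)
      (pow_pos (Nat.sub_pos_of_lt (TPIR.redT_lt_redN hTN)) _)
  have hD := TPIR.nonempty_design F hT hTN hM (TPIR.le_pow_of_rpow_le hℓ hq)
  have hrate := fun (D : TPIR.Design F N T M) θ => D.rate_scheme hT hTN hM θ
  let θ₀ : Fin M := ⟨0, by omega⟩
  rw [TPIR.Scheme.capacity_eq hTN M]
  have hcap : TPIR.IsCapacity N T M (1 / ∑ k ∈ Finset.range M, (T / N : ℝ) ^ k) := by
    obtain ⟨D⟩ := hD
    refine ⟨⟨F, _, _, _, D.scheme, D.scheme_isTPIR, θ₀, (hrate D θ₀).symm⟩, ?_⟩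
    rintro _ ⟨K, _, _, L, S, hS, θ, rfl⟩
    exact S.rate_le hS hT hTN θ
  refine ⟨hcap, hD, fun D => ⟨D.scheme_isLinear, D.scheme_isTPIR, fun θ => ?_⟩, ?_⟩
  · rw [hrate]
    exact hcap
  · intro K _ _ L S hS
    have hr : S.rate θ₀ = 1 / ∑ k ∈ Finset.range M, (T / N : ℝ) ^ k := (hS.2.2 θ₀).unique hcap
    -- Divisibility bounds L from below only if L ≠ 0; empty records have rate 0, not the capacity.
    have hL : 0 < L := by
      by_contra h0
      have h1 := TPIR.Scheme.geom_pos (N := N) (T := T) θ₀.pos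
      have h2 : (L : ℝ) = 0 := by exact_mod_cast Nat.eq_zero_of_not_pos h0
      rw [TPIR.Scheme.rate, TPIR.Scheme.entropy_record, h2, zero_mul, zero_div] at hr
      exact absurd hr (by positivity)
    exact TPIR.subpack_le_of_int hL (by omega) hM fun m h1 h2 =>
      S.exists_int_of_linear hS.2.1 hS.1 hT hTN θ₀ hr m h1 h2
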